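/- **Setting.** Let $W^{2\times2}$ be the algebra of $2\times 2$ matrix functions $A(t)=\sum_{k\in\mathbb Z}A_kt^k$ on the unit circle $\mathbb T$ with $\|A\|_W=\sum_k\|A_k\|_1<\infty$, where $\|\cdot\|_1$ is the maximum column sum norm, and let $W_+^{2\times2}$ (respectively $W_-^{2\times2}$) be the subalgebra of those $A$ with $A_k=0$ for $k<0$ (respectively for $k>0$). A right Wiener–Hopf factorisation of $A$ with partial indices $\rho_1\le\rho_2$ ($\rho_1,\rho_2\in\mathbb Z$) is a representation $A(t)=A_-(t)d_r(t)A_+(t)$ on $\mathbb T$ with $d_r(t)=\operatorname{diag}[t^{\rho_1},t^{\rho_2}]$, where $A_\pm$ is an invertible element of $W_\pm^{2\times2}$. It is stable if $\rho_2-\rho_1\le1$. Let $P=I_2$ or $P=J_2=\begin{pmatrix}0&1\\1&0\end{pmatrix}$, and write $A_-(t)=A_0+A_1t^{-1}+\cdots$, so that $A_0=A_-(\infty)$. A stable factorisation is $P$-normalised if: in the case $\rho_1=\rho_2$, $A_0=I_2$; in the case $\rho_2=\rho_1+1$, $P^{-1}A_0$ is lower triangular with unit diagonal and $(P^{-1}A_1)_{12}=0$.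 Let $0\le r_1<1<r_2\le\infty$ and $\theta\in\mathbb Z$. Let $\alpha_+$ be analytic in $|t|<r_2$ and let $\beta_-$ be analytic in $|t|>r_1$ with $\beta_-(t)\to0$ as $t\to\infty$. Write $\alpha_+(t)=\sum_{k\ge0}\alpha_kt^k$, $\beta_-(t)=\sum_{k\le-1}\beta_kt^k$, $\alpha_+^{(N)}(t)=\sum_{k=0}^N\alpha_kt^k$, $\beta_-^{(N)}(t)=\sum_{k=-N}^{-1}\beta_kt^k$, and $$a(t)=\begin{pmatrix}1&\beta_-(t)\\ \alpha_+(t)&t^\theta+\alpha_+(t)\beta_-(t)\end{pmatrix},\qquad a_N(t)=\begin{pmatrix}1&\beta_-^{(N)}(t)\\ \alpha_+^{(N)}(t)&t^\theta+\alpha_+^{(N)}(t)\beta_-^{(N)}(t)\end{pmatrix}.$$ A pair $(\zeta_1,\zeta_2)$ is admissible if $r_1<\zeta_1<1<\zeta_2<r_2$; in addition $\zeta_1=r_1$ is allowed if $r_1>0$ and $\beta_-$ extends continuously to $|t|=r_1$, and $\zeta_2=r_2$ is allowed if $r_2<\infty$ and $\alpha_+$ extends continuously to $|t|=r_2$. With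 $M_-(\zeta_1)=\max_{|t|=\zeta_1}|\beta_-(t)|$ and $M_+(\zeta_2)=\max_{|t|=\zeta_2}|\alpha_+(t)|$, put $$\delta_N(\zeta_1,\zeta_2)=\Bigl(1+\frac{\zeta_2M_+(\zeta_2)}{\zeta_2-1}\Bigr)\frac{\zeta_1^{N+1}M_-(\zeta_1)}{1-\zeta_1}+\Bigl(1+\frac{\zeta_1M_-(\zeta_1)}{1-\zeta_1}\Bigr)\frac{M_+(\zeta_2)}{\zeta_2^N(\zeta_2-1)},$$ and let $\sigma=\|d_r\|_W$, that is, $\sigma=1$ if $\theta$ is even and $\sigma=2$ if $\theta$ is odd. **Theorem.** Suppose that $a(t)$ admits a stable $P$-normalised factorisation $a=a_-d_ra_+$ with partial indices $\rho_1\le\rho_2$. Then there is $N_0$ such that for all $N>N_0$ the Laurent matrix polynomial $a_N$ admits a stable $P$-normalised factorisation $a_N=a_-^{(N)}d_ra_+^{(N)}$ with the same $P$ and the same partial indices $\rho_1,\rho_2$. Moreover, for every compact set $K$ of admissible pairs (in particular for every single admissible pair) there is $N_K\ge N_0$ such that for all $N>N_K$, all $(\zeta_1,\zeta_2)\in K$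 and every stable $P$-normalised factorisation $a_N=a_-^{(N)}d_ra_+^{(N)}$ with these partial indices, $$q_N(\zeta_1,\zeta_2)=\sigma\,\delta_N(\zeta_1,\zeta_2)\,\bigl\|(a_+^{(N)})^{-1}\bigr\|_W\,\bigl\|(a_-^{(N)})^{-1}\bigr\|_W<1 .$$ -/

import Mathlib

open Filter Topology
open scoped ENNReal

noncomputable section

namespace WienerHopf

/-- Functions of a complex variable with values in the complex `2 × 2` matrices. Only the values on
the unit circle matter in the definitions below. -/
abbrev MatFun : Type := ℂ → Matrix (Fin 2) (Fin 2) ℂ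

/-- The `k`-th Fourier coefficient of `f` on the unit circle, that is, the mean value of
`t ^ (-k) * f t` over `|t| = 1`. -/
def fourierCoef (f : ℂ → ℂ) (k : ℤ) : ℂ :=
  Real.circleAverage (fun t => t ^ (-k) * f t) 0 1

/-- The `k`-th matrix Fourier coefficient, taken entrywise. -/
def matCoef (A : MatFun) (k : ℤ) : Matrix (Fin 2) (Fin 2) ℂ :=
  Matrix.of fun i j => fourierCoef (fun t => A t i j) k

/-- The maximum column sum norm of a `2 × 2` matrix. -/
def colSumNorm (B : Matrix (Fin 2) (Fin 2) ℂ) : ℝ :=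
  max (‖B 0 0‖ + ‖B 1 0‖) (‖B 0 1‖ + ‖B 1 1‖)

/-- The norm of the matrix Wiener algebra: the sum of the norms of the Fourier coefficients. -/
def wienerNorm (A : MatFun) : ℝ :=
  ∑' k : ℤ, colSumNorm (matCoef A k)

/-- Membership in the matrix Wiener algebra: on the unit circle `A` is the sum of its absolutely
convergent Fourier series. -/
def MemWiener (A : MatFun) : Prop :=
  Summable (fun k : ℤ => colSumNorm (matCoef A k)) ∧
    ∀ t : ℂ, ‖t‖ = 1 → HasSum (fun k : ℤ => t ^ k • matCoef A k) (A t)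

/-- The subalgebra of the Fourier series with non-negative powers only. -/
def MemWienerPlus (A : MatFun) : Prop :=
  MemWiener A ∧ ∀ k : ℤ, k < 0 → matCoef A k = 0

/-- The subalgebra of the Fourier series with non-positive powers only. -/
def MemWienerMinus (A : MatFun) : Prop :=
  MemWiener A ∧ ∀ k : ℤ, 0 < k → matCoef A k = 0

/-- The pointwise inverse of a matrix function. -/
def matInv (A : MatFun) : MatFun := fun t => (A t)⁻¹

/-- The invertible elements of the plus subalgebra. -/
def IsUnitWienerPlus (A : MatFun) : Prop :=
  MemWienerPlus A ∧ (∀ t : ℂ, ‖t‖ = 1 → IsUnit (A t)) ∧ MemWienerPlus (matInv A)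

/-- The invertible elements of the minus subalgebra. -/
def IsUnitWienerMinus (A : MatFun) : Prop :=
  MemWienerMinus A ∧ (∀ t : ℂ, ‖t‖ = 1 → IsUnit (A t)) ∧ MemWienerMinus (matInv A)

/-- The diagonal factor `diag (t ^ ρ₁, t ^ ρ₂)`. -/
def diagFactor (ρ₁ ρ₂ : ℤ) : MatFun := fun t => !![t ^ ρ₁, 0; 0, t ^ ρ₂]

/-- `A = Am * diag (t ^ ρ₁, t ^ ρ₂) * Ap` on the unit circle is a right Wiener-Hopf factorisation,
with right partial indices `ρ₁ ≤ ρ₂`. -/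
structure IsRightFactorisation (A : MatFun) (ρ₁ ρ₂ : ℤ) (Am Ap : MatFun) : Prop where
  minus : IsUnitWienerMinus Am
  plus : IsUnitWienerPlus Ap
  le : ρ₁ ≤ ρ₂
  eq : ∀ t : ℂ, ‖t‖ = 1 → A t = Am t * diagFactor ρ₁ ρ₂ t * Ap t

/-- The permutation matrix of order two other than the identity. -/
def J₂ : Matrix (Fin 2) (Fin 2) ℂ := !![0, 1; 1, 0]

/-- `P`-normalisation of the minus factor `Am` of a factorisation with stable partial indices
`ρ₁ ≤ ρ₂ ≤ ρ₁ + 1`. Note that `matCoef Am 0` is the value of `Am` at infinity.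
If `ρ₁ = ρ₂`, this value has to be the identity matrix. If `ρ₂ = ρ₁ + 1`, it has to be `P * L` with
`L` unit lower triangular, and the coefficient of `t⁻¹` in the entry `(1, 2)` of `P⁻¹ * Am` has
to vanish. -/
def IsPNormalised (P : Matrix (Fin 2) (Fin 2) ℂ) (ρ₁ ρ₂ : ℤ) (Am : MatFun) : Prop :=
  (ρ₁ = ρ₂ → matCoef Am 0 = 1) ∧
  (ρ₂ = ρ₁ + 1 →
    (∃ l : ℂ, matCoef Am 0 = P * !![1, 0; l, 1]) ∧ (P⁻¹ * matCoef Am (-1)) 0 1 = 0)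

/-- A stable `P`-normalised right factorisation. -/
structure IsStablePFactorisation (P : Matrix (Fin 2) (Fin 2) ℂ) (A : MatFun) (ρ₁ ρ₂ : ℤ)
    (Am Ap : MatFun) : Prop where
  fact : IsRightFactorisation A ρ₁ ρ₂ Am Ap
  stable : ρ₂ - ρ₁ ≤ 1
  normalised : IsPNormalised P ρ₁ ρ₂ Am

/-- The matrix function in reduced form. -/
def reducedForm (θ : ℤ) (α β : ℂ → ℂ) : MatFun :=
  fun t => !![1, β t; α t, t ^ θ + α t * β t]

/-- The truncation `∑ k = 0, …, N` of the Fourier series of `α`. -/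
def truncPlus (α : ℂ → ℂ) (N : ℕ) : ℂ → ℂ :=
  fun t => ∑ k ∈ Finset.Icc (0 : ℤ) N, fourierCoef α k * t ^ k

/-- The truncation `∑ k = -N, …, -1` of the Fourier series of `β`. -/
def truncMinus (β : ℂ → ℂ) (N : ℕ) : ℂ → ℂ :=
  fun t => ∑ k ∈ Finset.Icc (-(N : ℤ)) (-1), fourierCoef β k * t ^ k

/-- The Laurent polynomial approximation of the matrix function in reduced form. -/
def reducedTrunc (θ : ℤ) (α β : ℂ → ℂ) (N : ℕ) : MatFun :=
  reducedForm θ (truncPlus α N) (truncMinus β N)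

/-- The maximum of `|f|` on the circle `|t| = ζ`. -/
def maxCircle (f : ℂ → ℂ) (ζ : ℝ) : ℝ :=
  sSup ((fun t => ‖f t‖) '' Metric.sphere (0 : ℂ) ζ)

/-- The bound `δ_N(ζ₁, ζ₂)` for the distance between the matrix function and its truncation. -/
def delta (α β : ℂ → ℂ) (N : ℕ) (ζ₁ ζ₂ : ℝ) : ℝ :=
  (1 + ζ₂ * maxCircle α ζ₂ / (ζ₂ - 1)) * (ζ₁ ^ (N + 1) * maxCircle β ζ₁ / (1 - ζ₁)) +
    (1 + ζ₁ * maxCircle β ζ₁ / (1 - ζ₁)) * (maxCircle α ζ₂ / (ζ₂ ^ N * (ζ₂ - 1)))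

/-- The Wiener norm of the diagonal factor of a stable factorisation: `1` if `θ` is even and `2` if
`θ` is odd. -/
def sigma (θ : ℤ) : ℝ := if Even θ then 1 else 2

/-- The quantity `q_N(ζ₁, ζ₂)`, computed from the factors `Am`, `Ap` of the truncation. -/
def qValue (θ : ℤ) (α β : ℂ → ℂ) (N : ℕ) (Am Ap : MatFun) (ζ₁ ζ₂ : ℝ) : ℝ :=
  sigma θ * delta α β N ζ₁ ζ₂ * wienerNorm (matInv Ap) * wienerNorm (matInv Am)

/-- The admissible pairs: `r₁ < ζ₁ < 1 < ζ₂ < r₂`, where `ζ₁ = r₁` is admitted as well if `r₁ > 0` and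
`β` is continuous up to the circle `|t| = r₁`, and `ζ₂ = r₂` is admitted as well if `r₂ < ∞` and `α`
is continuous up to the circle `|t| = r₂`. -/
def admissible (r₁ : ℝ) (r₂ : ℝ≥0∞) (α β : ℂ → ℂ) : Set (ℝ × ℝ) :=
  {ζ | (ζ.1 < 1 ∧ (r₁ < ζ.1 ∨ (ζ.1 = r₁ ∧ 0 < r₁ ∧ ContinuousOn β {z | r₁ ≤ ‖z‖}))) ∧
    (1 < ζ.2 ∧ (ENNReal.ofReal ζ.2 < r₂ ∨
      (ENNReal.ofReal ζ.2 = r₂ ∧ ContinuousOn α {z | ENNReal.ofReal ‖z‖ ≤ r₂})))}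

end WienerHopf

end

/-!
Write `D = diag (t ^ ρ₁, t ^ ρ₂)` and `b = b₋ D b₊`. Then `b₋` is invertible in the minus algebra
and `P`-normalised if and only if, for a suitable constant matrix `Q` depending only on `P` and
the indices, `z = D⁻¹ Q b₋ D` and `z⁻¹` both differ from the identity by a series of negative
powers. Hence stable `P`-normalised factorisations of `b` are the same as canonical factorisations
`z b₊` of `D⁻¹ Q b`, which are unique. A matrix `g` close to a product `x y` of such factors is
factored by writing `x⁻¹ g y⁻¹` as a canonical factorisation of a perturbation of the identity,
and the factors depend continuously on `g`. So every `a_N` with `N` large has a factorisation, and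
by uniqueness each one has inverse factors bounded independently of `N`, whereas `δ_N → 0`
uniformly on compact sets of admissible pairs.
-/

noncomputable section

namespace WienerHopf

section Canonical

lemma exists_continuousAt_apply_eq {𝕜 X E : Type*} [NontriviallyNormedField 𝕜] [TopologicalSpace X]
    [NormedAddCommGroup E] [NormedSpace 𝕜 E] [CompleteSpace E] {T : X → E →L[𝕜] E} {a : X}
    (hT : ContinuousAt T a) (ha : IsUnit (T a)) (c : E) :
    ∃ z : X → E, ContinuousAt z a ∧ ∀ᶠ x in 𝓝 a, T x (z x) = c := by
  refine ⟨fun x => Ring.inverse (T x) c, ?_, ?_⟩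
  · have hinv : ContinuousAt (fun x => Ring.inverse (T x)) a := by
      obtain ⟨u, hu⟩ := ha
      exact ContinuousAt.comp (g := Ring.inverse) (hu ▸ NormedRing.inverse_continuousAt u) hT
    exact hinv.clm_apply continuousAt_const
  · filter_upwards [hT.eventually (Units.isOpen.mem_nhds ha)] with x hx
    exact DFunLike.congr_fun (Ring.mul_inverse_cancel (T x) hx) c

lemma exists_continuousAt_units {X R : Type*} [TopologicalSpace X] [NormedRing R] [CompleteSpace R]
    {f : X → R} {a : X} (hf : ContinuousAt f a) (ha : IsUnit (f a)) :
    ∃ u : X → Rˣ, ContinuousAt u a ∧ ∀ᶠ x in 𝓝 a, ↑(u x) = f x := by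
  have hlift : ∀ x, ∃ u : Rˣ, IsUnit (f x) → ↑u = f x := fun x => by
    by_cases hx : IsUnit (f x)
    · exact ⟨hx.unit, fun _ => rfl⟩
    · exact ⟨1, fun h => absurd h hx⟩
  choose u hu using hlift
  have hev : ∀ᶠ x in 𝓝 a, ↑(u x) = f x := (hf.eventually (Units.isOpen.mem_nhds ha)).mono hu
  refine ⟨u, ?_, hev⟩
  rw [Units.isOpenEmbedding_val.isInducing.continuousAt_iff]
  exact hf.congr (hev.mono fun _ => Eq.symm)

variable {𝕜 R : Type*} [NontriviallyNormedField 𝕜] [NormedRing R] [NormedAlgebra 𝕜 R]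

/-- A continuous projection `p` of a Banach algebra whose range (the plus part) is a unital
subalgebra and whose kernel (the minus part) is closed under multiplication. -/
structure IsSplitting (p : R →L[𝕜] R) : Prop where
  idem : ∀ x, p (p x) = p x
  map_one : p 1 = 1
  map_mul : ∀ x y, p x = x → p y = y → p (x * y) = x * y
  map_mul_eq_zero : ∀ x y, p x = 0 → p y = 0 → p (x * y) = 0

/-- The canonical factorisation `b = y * x` of `b` with respect to the splitting `p`: the factor `x`
is invertible in the plus part, and `y` is invertible in `1 + ker p`. -/
structure IsCanonical (p : R →L[𝕜] R) (b : R) (y x : Rˣ) : Prop where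
  eq : b = y * x
  minus : p (y - 1) = 0
  minus_inv : p (↑y⁻¹ - 1) = 0
  plus : p x = x
  plus_inv : p ↑x⁻¹ = ↑x⁻¹

variable {p : R →L[𝕜] R}

lemma IsSplitting.map_mul_sub_one (hp : IsSplitting p) {y z : R} (hy : p (y - 1) = 0)
    (hz : p (z - 1) = 0) : p (y * z - 1) = 0 := by
  have h : y * z - 1 = (y - 1) * (z - 1) + (y - 1) + (z - 1) := by noncomm_ring
  rw [h, map_add, map_add, hp.map_mul_eq_zero _ _ hy hz, hy, hz, add_zero, add_zero]

lemma IsSplitting.eq_one (hp : IsSplitting p) {w : R} (hplus : p w = w) (hminus : p (w - 1) = 0) :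
    w = 1 := by
  rwa [map_sub, hp.map_one, hplus, sub_eq_zero] at hminus

lemma IsCanonical.unique (hp : IsSplitting p) {b : R} {y x z w : Rˣ} (h : IsCanonical p b y x)
    (h' : IsCanonical p b z w) : y = z ∧ x = w := by
  have hmul : y * x = z * w := Units.ext (by rw [Units.val_mul, Units.val_mul, ← h.eq, h'.eq])
  have hzw : z⁻¹ * y = w * x⁻¹ := by
    rw [inv_mul_eq_iff_eq_mul, ← mul_assoc, ← hmul, mul_inv_cancel_right]
  have hone : z⁻¹ * y = 1 := by
    refine Units.ext (hp.eq_one ?_ ?_)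
    · rw [hzw, Units.val_mul]
      exact hp.map_mul _ _ h'.plus h.plus_inv
    · rw [Units.val_mul]
      exact hp.map_mul_sub_one h'.minus_inv h.minus
  rw [inv_mul_eq_one] at hone
  exact ⟨hone.symm, by simpa [hone] using hmul⟩

lemma IsCanonical.mul_mul (hp : IsSplitting p) {b c : R} {y x z w : Rˣ} (h : IsCanonical p b y x)
    (h' : IsCanonical p (↑y⁻¹ * c * ↑x⁻¹) z w) : IsCanonical p c (y * z) (w * x) where
  eq := by
    have hc : c = y * (↑y⁻¹ * c * ↑x⁻¹) * x := by simp [mul_assoc]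
    rw [hc, h'.eq]
    simp [mul_assoc]
  minus := hp.map_mul_sub_one h.minus h'.minus
  minus_inv := by
    rw [mul_inv_rev]
    exact hp.map_mul_sub_one h'.minus_inv h.minus_inv
  plus := hp.map_mul _ _ h'.plus h.plus
  plus_inv := by
    rw [mul_inv_rev]
    exact hp.map_mul _ _ h.plus_inv h'.plus_inv

/-- `v * (d * u)` is at once in `1 + ker p` and in the range of `p`, hence equal to `1`. -/
lemma IsSplitting.isCanonical_inv_inv (hp : IsSplitting p) {d : R} {u v : Rˣ} (hu : p u = u)
    (hdu : p (d * u) = 1) (hv : p (v - 1) = 0) (hvd : p (v * d) = v * d) :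
    IsCanonical p d v⁻¹ u⁻¹ := by
  have hone : (v : R) * (d * u) = 1 := by
    refine hp.eq_one ?_ (hp.map_mul_sub_one hv ?_)
    · rw [← mul_assoc]
      exact hp.map_mul _ _ hvd hu
    · rw [map_sub, hdu, hp.map_one, sub_self]
  have hd : d * u = ↑v⁻¹ := ((Units.eq_inv_mul_iff_mul_eq v).2 hone).trans (mul_one _)
  have hd' : v * d = ↑u⁻¹ :=
    ((Units.eq_mul_inv_iff_mul_eq u).2 ((mul_assoc _ _ _).trans hone)).trans (one_mul _)
  refine ⟨?_, ?_, by simpa using hv, ?_, by simpa using hu⟩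
  · rw [← hd, mul_assoc, Units.mul_inv, mul_one]
  · rw [← hd, map_sub, hdu, hp.map_one, sub_self]
  · rw [← hd', hvd]

variable [CompleteSpace R]

lemma IsSplitting.exists_right_factor (hp : IsSplitting p) :
    ∃ u : R → R, ContinuousAt u 1 ∧ u 1 = 1 ∧ ∀ᶠ d in 𝓝 1, p (u d) = u d ∧ p (d * u d) = 1 := by
  let T (d : R) : R →L[𝕜] R := 1 + p ∘L ContinuousLinearMap.mul 𝕜 R (d - 1)
  have hT1 : T 1 = 1 := by ext z; simp [T]
  have hT : ContinuousAt T 1 := by fun_prop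
  obtain ⟨u, hu, hsol⟩ := exists_continuousAt_apply_eq hT (hT1 ▸ isUnit_one) 1
  refine ⟨u, hu, by simpa [hT1] using hsol.self_of_nhds, hsol.mono fun d hd => ?_⟩
  have hd' : u d + p ((d - 1) * u d) = 1 := hd
  have hplus : p (u d) = u d := by
    rw [eq_sub_of_add_eq hd', map_sub, hp.map_one, hp.idem]
  refine ⟨hplus, ?_⟩
  rwa [sub_mul, one_mul, map_sub, hplus, add_sub_cancel] at hd'

lemma IsSplitting.exists_left_factor (hp : IsSplitting p) :
    ∃ v : R → R, ContinuousAt v 1 ∧ v 1 = 1 ∧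
      ∀ᶠ d in 𝓝 1, p (v d - 1) = 0 ∧ p (v d * d) = v d * d := by
  let T (d : R) : R →L[𝕜] R := 1 + (1 - p) ∘L (ContinuousLinearMap.mul 𝕜 R).flip (d - 1)
  have hT1 : T 1 = 1 := by ext z; simp [T]
  have hT : ContinuousAt T 1 := by fun_prop
  obtain ⟨v, hv, hsol⟩ := exists_continuousAt_apply_eq hT (hT1 ▸ isUnit_one) 1
  refine ⟨v, hv, by simpa [hT1] using hsol.self_of_nhds, hsol.mono fun d hd => ?_⟩
  obtain ⟨e, he⟩ : ∃ e, v d * (d - 1) = e := ⟨_, rfl⟩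
  have hd' : v d + (e - p e) = 1 := by
    rw [← he]
    exact hd
  have hsub : v d - 1 = p e - e := by rw [← hd']; abel
  have hmul : v d * d = 1 + p e := by
    have hmul' : v d * d = e + v d := by rw [← he, mul_sub_one, sub_add_cancel]
    rw [hmul', ← hd']
    abel
  exact ⟨by rw [hsub, map_sub, hp.idem, sub_self], by rw [hmul, map_add, hp.map_one, hp.idem]⟩

lemma IsSplitting.exists_continuousAt_isCanonical (hp : IsSplitting p) :
    ∃ Y X : R → Rˣ, ContinuousAt Y 1 ∧ ContinuousAt X 1 ∧
      ∀ᶠ d in 𝓝 1, IsCanonical p d (Y d) (X d) := by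
  obtain ⟨u, hu, hu1, hright⟩ := hp.exists_right_factor
  obtain ⟨v, hv, hv1, hleft⟩ := hp.exists_left_factor
  obtain ⟨U, hU, hUu⟩ := exists_continuousAt_units hu (by rw [hu1]; exact isUnit_one)
  obtain ⟨V, hV, hVv⟩ := exists_continuousAt_units hv (by rw [hv1]; exact isUnit_one)
  refine ⟨fun d => (V d)⁻¹, fun d => (U d)⁻¹, hV.inv, hU.inv, ?_⟩
  filter_upwards [hright, hleft, hUu, hVv] with d ⟨hpu, hdu⟩ ⟨hpv, hvd⟩ hUd hVd
  rw [← hUd] at hpu hdu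
  rw [← hVd] at hpv hvd
  exact hp.isCanonical_inv_inv hpu hdu hpv hvd

theorem IsCanonical.exists_continuousAt (hp : IsSplitting p) {b : R} {y x : Rˣ}
    (h : IsCanonical p b y x) :
    ∃ Y X : R → Rˣ, ContinuousAt Y b ∧ ContinuousAt X b ∧
      ∀ᶠ c in 𝓝 b, IsCanonical p c (Y c) (X c) := by
  obtain ⟨Y, X, hY, hX, hYX⟩ := hp.exists_continuousAt_isCanonical
  let φ (c : R) : R := ↑y⁻¹ * c * ↑x⁻¹
  have hφ : ContinuousAt φ b := by fun_prop
  have hφb : φ b = 1 := by simp [φ, h.eq, mul_assoc]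
  rw [← hφb] at hY hX hYX
  exact ⟨fun c => y * Y (φ c), fun c => X (φ c) * x, continuousAt_const.mul (hY.comp hφ),
    (hX.comp hφ).mul continuousAt_const, (hφ.eventually hYX).mono fun c hc => h.mul_mul hp hc⟩

end Canonical

section CircleAverage

lemma hasSum_circleAverage {ι E : Type*} [Countable ι] [NormedAddCommGroup E] [NormedSpace ℝ E]
    {F : ι → ℂ → E} {f : ℂ → E} {b : ι → ℝ} {c : ℂ} {R : ℝ}
    (hF : ∀ i, ContinuousOn (F i) (Metric.sphere c |R|))
    (hb : ∀ i, ∀ z ∈ Metric.sphere c |R|, ‖F i z‖ ≤ b i) (hsum : Summable b)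
    (hf : ∀ z ∈ Metric.sphere c |R|, HasSum (fun i => F i z) (f z)) :
    HasSum (fun i => Real.circleAverage (F i) c R) (Real.circleAverage f c R) := by
  refine HasSum.const_smul _ (intervalIntegral.hasSum_integral_of_dominated_convergence
    (fun i _ => b i) (fun i => ?_)
    (fun i => .of_forall fun φ _ => hb i _ (circleMap_mem_sphere' ..))
    (.of_forall fun _ _ => hsum) intervalIntegrable_const
    (.of_forall fun φ _ => hf _ (circleMap_mem_sphere' ..)))
  exact ((hF i).comp_continuous (continuous_circleMap c R)
    fun φ => circleMap_mem_sphere' ..).aestronglyMeasurable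

lemma circleAverage_zpow (k : ℤ) :
    Real.circleAverage (fun t : ℂ => t ^ k) 0 1 = if k = 0 then 1 else 0 := by
  have hint : ∀ t ∈ Metric.sphere (0 : ℂ) 1, (t - 0)⁻¹ • t ^ k = (t - 0) ^ (k - 1) := by
    intro t ht
    rw [sub_zero, zpow_sub_one₀ (ne_zero_of_mem_unit_sphere ⟨t, ht⟩), smul_eq_mul, mul_comm]
  rw [Real.circleAverage_eq_circleIntegral one_ne_zero,
    circleIntegral.integral_congr zero_le_one hint]
  split_ifs with hk
  · simp only [hk, zero_sub, zpow_neg_one]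
    rw [circleIntegral.integral_sub_center_inv 0 one_ne_zero, smul_eq_mul,
      inv_mul_cancel₀ Complex.two_pi_I_ne_zero]
  · rw [circleIntegral.integral_sub_zpow_of_ne (by lia), smul_zero]

lemma fourierCoef_const_mul_zpow (c : ℂ) (n k : ℤ) :
    fourierCoef (fun t => c * t ^ n) k = if n = k then c else 0 := by
  have hmul : Set.EqOn (fun t : ℂ => t ^ (-k) * (c * t ^ n)) (fun t => c • t ^ (n - k))
      (Metric.sphere 0 |1|) := fun t ht => by
    have ht0 : t ≠ 0 := ne_zero_of_mem_unit_sphere ⟨t, by simpa using ht⟩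
    simp only [smul_eq_mul, sub_eq_neg_add, zpow_add₀ ht0]
    ring
  rw [fourierCoef, Real.circleAverage_congr_sphere hmul, Real.circleAverage_fun_smul,
    circleAverage_zpow]
  simp [sub_eq_zero]

lemma fourierCoef_eq_of_hasSum {f : ℂ → ℂ} {x : ℤ → ℂ} (hx : Summable fun n => ‖x n‖)
    (hf : ∀ t : ℂ, ‖t‖ = 1 → HasSum (fun n => x n * t ^ n) (f t)) (k : ℤ) :
    fourierCoef f k = x k := by
  have hsum : HasSum (fun n => fourierCoef (fun t => x n * t ^ n) k) (fourierCoef f k) := by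
    refine hasSum_circleAverage (b := fun n => ‖x n‖) (fun n => ?_) (fun n t ht => ?_) hx
      fun t ht => (hf t (by simpa using ht)).mul_left _
    · have ht0 : ∀ t ∈ Metric.sphere (0 : ℂ) |1|, t ≠ 0 := fun t ht =>
        ne_zero_of_mem_unit_sphere ⟨t, by simpa using ht⟩
      exact (continuousOn_id.zpow₀ _ fun t ht => .inl (ht0 t ht)).mul
        (continuousOn_const.mul (continuousOn_id.zpow₀ _ fun t ht => .inl (ht0 t ht)))
    · have ht1 : ‖t‖ = 1 := by simpa using ht
      simp [ht1]
  simp only [fourierCoef_const_mul_zpow] at hsum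
  refine hsum.unique ?_
  simpa using hasSum_single (f := fun n => if n = k then x n else 0) k fun n hn => if_neg hn

end CircleAverage

/-- The Wiener algebra of the circle. An absolutely convergent Fourier series is encoded by the
summable family of its coefficients, so that multiplication is convolution. -/
def WienerAlgebra : Type := lp (fun _ : ℤ => ℂ) 1

namespace WienerAlgebra

instance : NormedAddCommGroup WienerAlgebra :=
  inferInstanceAs (NormedAddCommGroup (lp (fun _ : ℤ => ℂ) 1))

instance : NormedSpace ℂ WienerAlgebra :=
  inferInstanceAs (NormedSpace ℂ (lp (fun _ : ℤ => ℂ) 1))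

instance : CompleteSpace WienerAlgebra :=
  inferInstanceAs (CompleteSpace (lp (fun _ : ℤ => ℂ) 1))

instance : FunLike WienerAlgebra ℤ ℂ where
  coe x := x.1
  coe_injective _ _ h := lp.ext h

@[ext] lemma ext {x y : WienerAlgebra} (h : ∀ k, x k = y k) : x = y := DFunLike.ext _ _ h

@[simp] lemma zero_apply (k : ℤ) : (0 : WienerAlgebra) k = 0 := rfl
@[simp] lemma add_apply (x y : WienerAlgebra) (k : ℤ) : (x + y) k = x k + y k := rfl
@[simp] lemma sub_apply (x y : WienerAlgebra) (k : ℤ) : (x - y) k = x k - y k := rfl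
@[simp] lemma smul_apply (c : ℂ) (x : WienerAlgebra) (k : ℤ) : (c • x) k = c * x k := rfl

lemma hasSum_norm (x : WienerAlgebra) : HasSum (fun k => ‖x k‖) ‖x‖ := by
  have h := lp.hasSum_norm (E := fun _ : ℤ => ℂ) (p := 1) (by simp) x
  simp only [ENNReal.toReal_one, Real.rpow_one] at h
  exact h

lemma norm_apply_le (x : WienerAlgebra) (k : ℤ) : ‖x k‖ ≤ ‖x‖ :=
  lp.norm_apply_le_norm (E := fun _ : ℤ => ℂ) one_ne_zero x k

/-- The element with prescribed Fourier coefficients. -/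
def ofSummable (f : ℤ → ℂ) (hf : Summable fun k => ‖f k‖) : WienerAlgebra :=
  ⟨f, memℓp_gen (by simpa using hf)⟩

@[simp] lemma ofSummable_apply (f : ℤ → ℂ) (hf : Summable fun k => ‖f k‖) (k : ℤ) :
    ofSummable f hf k = f k := rfl

/-- The `k`-th Fourier coefficient as a continuous linear functional. -/
def coef (k : ℤ) : WienerAlgebra →L[ℂ] ℂ :=
  LinearMap.mkContinuous
    { toFun := fun x => x k, map_add' := fun _ _ => rfl, map_smul' := fun _ _ => rfl } 1
    fun x => by rw [one_mul]; exact norm_apply_le x k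

@[simp] lemma coef_apply (k : ℤ) (x : WienerAlgebra) : coef k x = x k := rfl

/-- Multiplication by `t ^ k`. -/
def shift (k : ℤ) : WienerAlgebra →ₗᵢ[ℂ] WienerAlgebra where
  toFun x := ofSummable (fun n => x (n - k))
    (((Equiv.subRight k).summable_iff (f := fun n => ‖x n‖)).2 x.hasSum_norm.summable)
  map_add' _ _ := rfl
  map_smul' _ _ := rfl
  norm_map' x := (hasSum_norm _).unique ((Equiv.subRight k).hasSum_iff.2 x.hasSum_norm)

@[simp] lemma shift_apply (k n : ℤ) (x : WienerAlgebra) : shift k x n = x (n - k) := rfl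

/-- The function `t ^ k`. -/
def monomial (k : ℤ) : WienerAlgebra := lp.single 1 k (1 : ℂ)

lemma monomial_apply (k n : ℤ) : monomial k n = if n = k then 1 else 0 := by
  split_ifs with h
  · rw [h]
    exact lp.single_apply_self (E := fun _ : ℤ => ℂ) 1 k (1 : ℂ)
  · exact lp.single_apply_ne (E := fun _ : ℤ => ℂ) 1 k (1 : ℂ) h

lemma hasSum_monomial (x : WienerAlgebra) : HasSum (fun k => x k • monomial k) x := by
  refine (lp.hasSum_single (E := fun _ : ℤ => ℂ) (p := 1) (by simp) x).congr_fun fun k => ?_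
  refine ((lp.single_smul (E := fun _ : ℤ => ℂ) (𝕜 := ℂ) 1 k (x k) 1).symm.trans ?_)
  rw [smul_eq_mul, mul_one]
  rfl

instance : Mul WienerAlgebra := ⟨fun x y => ∑' k, x k • shift k y⟩

instance : One WienerAlgebra := ⟨monomial 0⟩

lemma one_apply (n : ℤ) : (1 : WienerAlgebra) n = if n = 0 then 1 else 0 := monomial_apply 0 n

lemma hasSum_norm_mul (x y : WienerAlgebra) :
    HasSum (fun k => ‖x k • shift k y‖) (‖x‖ * ‖y‖) := by
  simpa [norm_smul] using x.hasSum_norm.mul_right ‖y‖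

lemma hasSum_mul (x y : WienerAlgebra) : HasSum (fun k => x k • shift k y) (x * y) :=
  (Summable.of_norm (hasSum_norm_mul x y).summable).hasSum

lemma hasSum_mul_apply (x y : WienerAlgebra) (n : ℤ) :
    HasSum (fun k => x k * y (n - k)) ((x * y) n) := by
  simpa using (hasSum_mul x y).mapL (coef n)

lemma summable_ev (t : Circle) (x : WienerAlgebra) : Summable fun k => x k * (t : ℂ) ^ k :=
  Summable.of_norm (by simpa [Circle.norm_coe] using x.hasSum_norm.summable)

/-- Evaluation at a point of the circle. -/
def ev (t : Circle) : WienerAlgebra →L[ℂ] ℂ :=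
  LinearMap.mkContinuous
    { toFun := fun x => ∑' k, x k * (t : ℂ) ^ k
      map_add' := fun x y => by
        simp only [add_apply, add_mul]
        exact (summable_ev t x).tsum_add (summable_ev t y)
      map_smul' := fun c x => by simp [mul_assoc, tsum_mul_left] } 1
    fun x => by
      rw [one_mul]
      exact tsum_of_norm_bounded x.hasSum_norm fun k => by simp [Circle.norm_coe]

lemma hasSum_ev (t : Circle) (x : WienerAlgebra) : HasSum (fun k => x k * (t : ℂ) ^ k) (ev t x) :=
  (summable_ev t x).hasSum

lemma fourierCoef_eq_of_ev {f : ℂ → ℂ} {x : WienerAlgebra} (h : ∀ t : Circle, f t = ev t x)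
    (k : ℤ) : fourierCoef f k = x k := by
  refine fourierCoef_eq_of_hasSum x.hasSum_norm.summable (fun t ht => ?_) k
  obtain ⟨t, rfl⟩ : ∃ s : Circle, ↑s = t := ⟨⟨t, mem_sphere_zero_iff_norm.2 ht⟩, rfl⟩
  rw [h]
  exact hasSum_ev t x

lemma ext_ev {x y : WienerAlgebra} (h : ∀ t, ev t x = ev t y) : x = y := by
  ext k
  let f (z : ℂ) : ℂ := ∑' n, x n * z ^ n
  have hx : ∀ t : Circle, f t = ev t x := fun _ => rfl
  rw [← fourierCoef_eq_of_ev hx, ← fourierCoef_eq_of_ev fun t => (hx t).trans (h t)]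

@[simp] lemma ev_monomial (t : Circle) (k : ℤ) : ev t (monomial k) = (t : ℂ) ^ k := by
  refine (hasSum_ev t _).unique ?_
  simpa [monomial_apply] using hasSum_single (f := fun n => monomial k n * (t : ℂ) ^ n) k
    fun n hn => by rw [monomial_apply, if_neg hn, zero_mul]

@[simp] lemma ev_one (t : Circle) : ev t 1 = 1 := (ev_monomial t 0).trans (zpow_zero _)

lemma ev_shift (t : Circle) (k : ℤ) (x : WienerAlgebra) :
    ev t (shift k x) = (t : ℂ) ^ k * ev t x := by
  refine (hasSum_ev t _).unique ?_
  refine (((Equiv.subRight k).hasSum_iff.2 (hasSum_ev t x)).mul_left _).congr_fun fun n => ?_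
  rw [shift_apply, Function.comp_apply, Equiv.subRight_apply, mul_left_comm,
    ← zpow_add₀ (Circle.coe_ne_zero t), add_sub_cancel]

@[simp] lemma ev_mul (t : Circle) (x y : WienerAlgebra) : ev t (x * y) = ev t x * ev t y := by
  refine ((hasSum_mul x y).mapL (ev t)).unique ?_
  simpa [ev_shift, mul_assoc] using (hasSum_ev t x).mul_right (ev t y)

instance : NormedCommRing WienerAlgebra :=
  { (inferInstance : NormedAddCommGroup WienerAlgebra) with
    mul := (· * ·)
    one := 1
    mul_assoc := fun x y z => ext_ev fun t => by simp [mul_assoc]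
    mul_comm := fun x y => ext_ev fun t => by simp [mul_comm]
    one_mul := fun x => ext_ev fun t => by simp
    mul_one := fun x => ext_ev fun t => by simp
    zero_mul := fun x => ext_ev fun t => by simp
    mul_zero := fun x => ext_ev fun t => by simp
    left_distrib := fun x y z => ext_ev fun t => by simp [mul_add]
    right_distrib := fun x y z => ext_ev fun t => by simp [add_mul]
    norm_mul_le := fun x y => tsum_of_norm_bounded (hasSum_norm_mul x y) fun _ => le_rfl }

instance : NormedAlgebra ℂ WienerAlgebra :=
  { Algebra.ofModule (fun c x y => ext_ev fun t => by simp [mul_assoc])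
      (fun c x y => ext_ev fun t => by simp [mul_left_comm]) with
    norm_smul_le := norm_smul_le }

@[simp] lemma algebraMap_mul_apply (c : ℂ) (x : WienerAlgebra) (k : ℤ) :
    (algebraMap ℂ WienerAlgebra c * x) k = c * x k := by
  rw [← Algebra.smul_def, smul_apply]

/-- Evaluation at a point of the circle as a ring homomorphism. -/
def evHom (t : Circle) : WienerAlgebra →+* ℂ where
  toFun := ev t
  map_one' := ev_one t
  map_mul' := ev_mul t
  map_zero' := map_zero _
  map_add' := map_add _

lemma monomial_mul (j : ℤ) (x : WienerAlgebra) : monomial j * x = shift j x :=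
  ext_ev fun t => by simp [ev_shift]

lemma monomial_mul_monomial (j k : ℤ) : monomial j * monomial k = monomial (j + k) :=
  ext_ev fun t => by simp [zpow_add₀ (Circle.coe_ne_zero t)]

/-- The subspace of the series whose exponents lie in `S`. -/
def supported (S : Set ℤ) : Submodule ℂ WienerAlgebra where
  carrier := {x | ∀ k ∉ S, x k = 0}
  zero_mem' _ _ := rfl
  add_mem' hx hy k hk := by rw [add_apply, hx k hk, hy k hk, add_zero]
  smul_mem' c x hx k hk := by rw [smul_apply, hx k hk, mul_zero]

lemma mem_supported {S : Set ℤ} {x : WienerAlgebra} : x ∈ supported S ↔ ∀ k ∉ S, x k = 0 := Iff.rfl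

lemma supported_mono {S T : Set ℤ} (h : S ⊆ T) : supported S ≤ supported T :=
  fun _ hx k hk => hx k (Set.notMem_subset h hk)

open scoped Pointwise in
lemma mul_mem_supported {S T U : Set ℤ} (h : S + T ⊆ U) {x y : WienerAlgebra}
    (hx : x ∈ supported S) (hy : y ∈ supported T) : x * y ∈ supported U := by
  intro k hk
  refine (hasSum_mul_apply x y k).unique (hasSum_zero.congr_fun fun j => ?_)
  by_cases hj : j ∈ S
  · have hkj : k - j ∉ T := fun hT => hk (h ⟨j, hj, k - j, hT, add_sub_cancel j k⟩)
    rw [hy _ hkj, mul_zero]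
  · rw [hx j hj, zero_mul]

lemma one_mem_supported {S : Set ℤ} (h : 0 ∈ S) : 1 ∈ supported S := fun k hk => by
  rw [one_apply, if_neg (ne_of_mem_of_not_mem h hk).symm]

/-- The projection discarding the exponents outside of `S`. -/
def proj (S : Set ℤ) : WienerAlgebra →L[ℂ] WienerAlgebra :=
  LinearMap.mkContinuous
    { toFun := fun x => ofSummable (S.indicator x)
        (x.hasSum_norm.summable.of_nonneg_of_le (fun _ => norm_nonneg _)
          fun _ => norm_indicator_le_norm_self _ _)
      map_add' := fun x y => ext fun k => congrFun (Set.indicator_add S x y) k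
      map_smul' := fun c x => ext fun k => congrFun (Set.indicator_const_smul S c x) k } 1
    fun x => by
      rw [one_mul]
      exact hasSum_le (fun _ => norm_indicator_le_norm_self _ _) (hasSum_norm _) x.hasSum_norm

lemma proj_eq_self_iff {S : Set ℤ} {x : WienerAlgebra} : proj S x = x ↔ x ∈ supported S := by
  rw [DFunLike.ext'_iff, mem_supported]
  exact Set.indicator_eq_self.trans Function.support_subset_iff'

lemma proj_eq_zero_iff {S : Set ℤ} {x : WienerAlgebra} : proj S x = 0 ↔ x ∈ supported Sᶜ := by
  rw [DFunLike.ext'_iff, mem_supported]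
  exact Set.indicator_eq_zero'.trans (Set.disjoint_right.trans
    (forall_congr' fun k => by simp))

open scoped Pointwise in
lemma isSplitting_proj {S : Set ℤ} (h0 : 0 ∈ S) (hS : S + S ⊆ S) (hSc : Sᶜ + Sᶜ ⊆ Sᶜ) :
    IsSplitting (proj S) where
  idem x := proj_eq_self_iff.2 fun k hk => Set.indicator_of_notMem hk x
  map_one := proj_eq_self_iff.2 (one_mem_supported h0)
  map_mul x y hx hy := by
    rw [proj_eq_self_iff] at *
    exact mul_mem_supported hS hx hy
  map_mul_eq_zero x y hx hy := by
    rw [proj_eq_zero_iff] at *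
    exact mul_mem_supported hSc hx hy

end WienerAlgebra

section Matrix

open scoped Matrix.Norms.Operator Pointwise

variable {n 𝕜 R : Type*} [NontriviallyNormedField 𝕜] [NormedRing R] [NormedAlgebra 𝕜 R]

/-- The continuous linear map applying `p` to each entry of a matrix. -/
def entrywise (p : R →L[𝕜] R) : Matrix n n R →L[𝕜] Matrix n n R where
  toLinearMap := p.toLinearMap.mapMatrix
  cont := continuous_id.matrix_map p.continuous

lemma entrywise_eq_iff {p : R →L[𝕜] R} {x y : Matrix n n R} :
    entrywise p x = y ↔ ∀ i j, p (x i j) = y i j := Matrix.ext_iff.symm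

lemma IsSplitting.entrywise [Fintype n] [DecidableEq n] {p : R →L[𝕜] R} (hp : IsSplitting p) :
    IsSplitting (entrywise (n := n) p) where
  idem x := entrywise_eq_iff.2 fun i j => hp.idem (x i j)
  map_one := entrywise_eq_iff.2 fun i j => by
    rw [Matrix.one_apply]
    split_ifs
    exacts [hp.map_one, map_zero p]
  map_mul x y hx hy := entrywise_eq_iff.2 fun i j => by
    rw [Matrix.mul_apply, map_sum]
    exact Finset.sum_congr rfl fun k _ =>
      hp.map_mul _ _ (entrywise_eq_iff.1 hx i k) (entrywise_eq_iff.1 hy k j)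
  map_mul_eq_zero x y hx hy := entrywise_eq_iff.2 fun i j => by
    rw [Matrix.mul_apply, map_sum]
    exact Finset.sum_eq_zero fun k _ =>
      hp.map_mul_eq_zero _ _ (entrywise_eq_iff.1 hx i k) (entrywise_eq_iff.1 hy k j)

end Matrix

/-- The matrix Wiener algebra. -/
abbrev WienerMat (n : Type*) : Type _ := Matrix n n WienerAlgebra

namespace WienerMat

open WienerAlgebra
open scoped Matrix.Norms.Operator Pointwise

variable {n : Type*}

/-- The matrices of series whose exponents lie in `S`. -/
def supported (S : Set ℤ) : Submodule ℂ (WienerMat n) where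
  carrier := {x | ∀ i j, x i j ∈ WienerAlgebra.supported S}
  zero_mem' _ _ := zero_mem _
  add_mem' hx hy i j := add_mem (hx i j) (hy i j)
  smul_mem' c _ hx i j := Submodule.smul_mem _ c (hx i j)

lemma mem_supported {S : Set ℤ} {x : WienerMat n} :
    x ∈ supported S ↔ ∀ i j, ∀ k ∉ S, x i j k = 0 := Iff.rfl

lemma supported_mono {S T : Set ℤ} (h : S ⊆ T) :
    supported S ≤ (supported T : Submodule ℂ (WienerMat n)) :=
  fun _ hx i j => WienerAlgebra.supported_mono h (hx i j)

lemma one_apply_apply [DecidableEq n] (i j : n) (k : ℤ) :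
    (1 : WienerMat n) i j k = if k = 0 then (1 : Matrix n n ℂ) i j else 0 := by
  by_cases h : i = j <;> simp [Matrix.one_apply, h, one_apply]

lemma one_mem_supported [DecidableEq n] {S : Set ℤ} (h : 0 ∈ S) :
    (1 : WienerMat n) ∈ supported S := fun i j k hk => by
  rw [one_apply_apply, if_neg (by rintro rfl; exact hk h)]

/-- The splitting of the matrix Wiener algebra into the series of non-negative powers and those of
negative powers. -/
def projPlus : WienerMat n →L[ℂ] WienerMat n := entrywise (proj (Set.Ici 0))

lemma projPlus_eq_self_iff {x : WienerMat n} : projPlus x = x ↔ x ∈ supported (Set.Ici 0) :=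
  entrywise_eq_iff.trans (forall₂_congr fun _ _ => proj_eq_self_iff)

lemma projPlus_eq_zero_iff {x : WienerMat n} : projPlus x = 0 ↔ x ∈ supported (Set.Iio 0) := by
  rw [← Set.compl_Ici]
  exact entrywise_eq_iff.trans (forall₂_congr fun _ _ => proj_eq_zero_iff)

variable [Fintype n]

lemma mul_mem_supported {S T U : Set ℤ} (h : S + T ⊆ U) {x y : WienerMat n}
    (hx : x ∈ supported S) (hy : y ∈ supported T) : x * y ∈ supported U := fun i j => by
  rw [Matrix.mul_apply]
  exact sum_mem fun k _ => WienerAlgebra.mul_mem_supported h (hx i k) (hy k j)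

lemma mul_mem_supported_Iic_zero {x y : WienerMat n} (hx : x ∈ supported (Set.Iic 0))
    (hy : y ∈ supported (Set.Iic 0)) : x * y ∈ supported (Set.Iic 0) :=
  mul_mem_supported ((Set.Iic_add_Iic_subset 0 0).trans_eq (by rw [add_zero])) hx hy

variable [DecidableEq n]

lemma isSplitting_projPlus : IsSplitting (projPlus : WienerMat n →L[ℂ] WienerMat n) := by
  refine (isSplitting_proj Set.self_mem_Ici ?_ ?_).entrywise
  · exact (Set.Ici_add_Ici_subset 0 0).trans_eq (by rw [add_zero])
  · rw [Set.compl_Ici]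
    exact (Set.add_subset_add_left Set.Iio_subset_Iic_self).trans
      ((Set.Iio_add_Iic_subset 0 0).trans_eq (by rw [add_zero]))

instance : @CompleteSpace (WienerMat n) PseudoMetricSpace.toUniformSpace :=
  inferInstanceAs (CompleteSpace (n → n → WienerAlgebra))

/-- Evaluation at a point of the circle. -/
def ev (t : Circle) : WienerMat n →+* Matrix n n ℂ := (evHom t).mapMatrix

@[simp] lemma ev_apply (t : Circle) (x : WienerMat n) (i j : n) :
    ev t x i j = WienerAlgebra.ev t (x i j) := rfl

lemma ext_ev {x y : WienerMat n} (h : ∀ t, ev t x = ev t y) : x = y := by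
  ext1 i j
  exact WienerAlgebra.ext_ev fun t => congrFun₂ (h t) i j

/-- The constant matrix functions. -/
def const : Matrix n n ℂ →+* WienerMat n := (algebraMap ℂ WienerAlgebra).mapMatrix

lemma const_mul_map_coef (C : Matrix n n ℂ) (x : WienerMat n) (k : ℤ) :
    (const C * x).map (coef k) = C * x.map (coef k) := by
  ext i j
  simp [const, Matrix.mul_apply, map_sum]

lemma const_mem_supported (C : Matrix n n ℂ) : const C ∈ supported (Set.Iic 0) := fun i j => by
  rw [const, RingHom.mapMatrix_apply, Matrix.map_apply, Algebra.algebraMap_eq_smul_one]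
  exact Submodule.smul_mem _ _ (WienerAlgebra.one_mem_supported Set.self_mem_Iic)

/-- The diagonal matrix function with entries `t ^ ρ i`. -/
def diag (ρ : n → ℤ) : (WienerMat n)ˣ where
  val := Matrix.diagonal fun i => monomial (ρ i)
  inv := Matrix.diagonal fun i => monomial (-ρ i)
  val_inv := by
    simp only [Matrix.diagonal_mul_diagonal, monomial_mul_monomial, add_neg_cancel]
    exact Matrix.diagonal_one
  inv_val := by
    simp only [Matrix.diagonal_mul_diagonal, monomial_mul_monomial, neg_add_cancel]
    exact Matrix.diagonal_one

lemma diag_conj_apply (ρ : n → ℤ) (x : WienerMat n) (i j : n) (k : ℤ) :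
    (↑(diag ρ)⁻¹ * x * ↑(diag ρ) : WienerMat n) i j k = x i j (k - (ρ j - ρ i)) := by
  change (Matrix.diagonal (fun i => monomial (-ρ i)) * x *
    Matrix.diagonal (fun i => monomial (ρ i)) : WienerMat n) i j k = _
  rw [Matrix.mul_diagonal, Matrix.diagonal_mul, mul_right_comm, monomial_mul_monomial,
    monomial_mul, shift_apply, neg_add_eq_sub]

lemma ev_diag (t : Circle) (ρ₁ ρ₂ : ℤ) :
    ev t (diag ![ρ₁, ρ₂]) = diagFactor ρ₁ ρ₂ t := by
  ext i j
  fin_cases i <;> fin_cases j <;> simp [diag, diagFactor]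

end WienerMat

section Represents

open WienerMat

lemma norm_apply_le_colSumNorm (B : Matrix (Fin 2) (Fin 2) ℂ) (i j : Fin 2) :
    ‖B i j‖ ≤ colSumNorm B := by
  unfold colSumNorm
  fin_cases i <;> fin_cases j <;> simp

lemma colSumNorm_le_sum (B : Matrix (Fin 2) (Fin 2) ℂ) : colSumNorm B ≤ ∑ i, ∑ j, ‖B i j‖ := by
  rw [Finset.sum_comm, Fin.sum_univ_two, Fin.sum_univ_two, Fin.sum_univ_two]
  exact max_le_add_of_nonneg (by positivity) (by positivity)

/-- `x` is the Fourier series of the matrix function `A`, which it determines on the circle. -/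
def Represents (x : WienerMat (Fin 2)) (A : MatFun) : Prop := ∀ t : Circle, A t = ev t x

lemma exists_represents (x : WienerMat (Fin 2)) : ∃ A, Represents x A :=
  ⟨fun t => Matrix.of fun i j => ∑' k, x i j k * t ^ k, fun _ => rfl⟩

namespace Represents

variable {x : WienerMat (Fin 2)} {A : MatFun}

lemma matCoef_eq (h : Represents x A) (k : ℤ) : matCoef A k = x.map (WienerAlgebra.coef k) := by
  ext i j
  exact WienerAlgebra.fourierCoef_eq_of_ev (f := fun t => A t i j) (fun t => congrFun₂ (h t) i j) k

lemma hasSum_sum_norm (h : Represents x A) :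
    HasSum (fun k => ∑ i, ∑ j, ‖matCoef A k i j‖) (∑ i, ∑ j, ‖x i j‖) := by
  simp only [h.matCoef_eq]
  exact hasSum_sum fun i _ => hasSum_sum fun j _ => (x i j).hasSum_norm

lemma summable_colSumNorm (h : Represents x A) : Summable fun k => colSumNorm (matCoef A k) :=
  h.hasSum_sum_norm.summable.of_nonneg_of_le
    (fun _ => (norm_nonneg _).trans (norm_apply_le_colSumNorm _ 0 0)) fun _ => colSumNorm_le_sum _

lemma wienerNorm_le (h : Represents x A) : wienerNorm A ≤ ∑ i, ∑ j, ‖x i j‖ :=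
  hasSum_le (fun _ => colSumNorm_le_sum _) h.summable_colSumNorm.hasSum h.hasSum_sum_norm

lemma memWiener (h : Represents x A) : MemWiener A := by
  refine ⟨h.summable_colSumNorm, fun t ht => Pi.hasSum.2 fun i => Pi.hasSum.2 fun j => ?_⟩
  obtain ⟨t, rfl⟩ : ∃ s : Circle, ↑s = t := ⟨⟨t, mem_sphere_zero_iff_norm.2 ht⟩, rfl⟩
  rw [h t]
  refine (WienerAlgebra.hasSum_ev t (x i j)).congr_fun fun k => ?_
  rw [h.matCoef_eq, Matrix.smul_apply, Matrix.map_apply, WienerAlgebra.coef_apply, smul_eq_mul,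
    mul_comm]

lemma memWienerPlus_iff (h : Represents x A) : MemWienerPlus A ↔ x ∈ supported (Set.Ici 0) := by
  simp only [MemWienerPlus, h.memWiener, true_and, h.matCoef_eq, WienerMat.mem_supported,
    Set.mem_Ici, not_le, ← Matrix.ext_iff, Matrix.map_apply, Matrix.zero_apply,
    WienerAlgebra.coef_apply]
  exact ⟨fun h i j k hk => h k hk i j, fun h k hk i j => h i j k hk⟩

lemma memWienerMinus_iff (h : Represents x A) : MemWienerMinus A ↔ x ∈ supported (Set.Iic 0) := by
  simp only [MemWienerMinus, h.memWiener, true_and, h.matCoef_eq, WienerMat.mem_supported,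
    Set.mem_Iic, not_le, ← Matrix.ext_iff, Matrix.map_apply, Matrix.zero_apply,
    WienerAlgebra.coef_apply]
  exact ⟨fun h i j k hk => h k hk i j, fun h k hk i j => h i j k hk⟩

lemma matInv {u : (WienerMat (Fin 2))ˣ} (h : Represents u A) :
    Represents ↑u⁻¹ (WienerHopf.matInv A) := fun t => by
  rw [WienerHopf.matInv, h t]
  exact Matrix.inv_eq_right_inv (by rw [← map_mul, Units.mul_inv, map_one])

end Represents

lemma MemWiener.exists_represents {A : MatFun} (h : MemWiener A) : ∃ x, Represents x A := by
  refine ⟨Matrix.of fun i j => .ofSummable (fun k => matCoef A k i j)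
    (h.1.of_nonneg_of_le (fun _ => norm_nonneg _) fun k => norm_apply_le_colSumNorm _ i j),
    fun t => ?_⟩
  ext i j
  refine (Pi.hasSum.1 (Pi.hasSum.1 (h.2 t t.norm_coe) i) j).unique ?_
  exact (WienerAlgebra.hasSum_ev t _).congr_fun fun k => by simp [mul_comm]

lemma exists_unit_represents_iff {A : MatFun} :
    (∃ u : (WienerMat (Fin 2))ˣ, Represents u A) ↔
      MemWiener A ∧ (∀ t : ℂ, ‖t‖ = 1 → IsUnit (A t)) ∧ MemWiener (matInv A) := by
  constructor
  · rintro ⟨u, hu⟩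
    refine ⟨hu.memWiener, fun t ht => ?_, hu.matInv.memWiener⟩
    obtain ⟨t, rfl⟩ : ∃ s : Circle, ↑s = t := ⟨⟨t, mem_sphere_zero_iff_norm.2 ht⟩, rfl⟩
    rw [hu t]
    exact u.isUnit.map (ev t)
  · rintro ⟨hA, hunit, hA'⟩
    obtain ⟨x, hx⟩ := hA.exists_represents
    obtain ⟨y, hy⟩ := hA'.exists_represents
    have hxy : x * y = 1 := ext_ev fun t => by
      rw [map_mul, map_one, ← hx t, ← hy t, matInv]
      exact Matrix.mul_nonsing_inv _ ((Matrix.isUnit_iff_isUnit_det _).1 (hunit t t.norm_coe))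
    exact ⟨⟨x, y, hxy, mul_eq_one_comm.1 hxy⟩, hx⟩

lemma isUnitWienerPlus_iff {A : MatFun} :
    IsUnitWienerPlus A ↔ ∃ u : (WienerMat (Fin 2))ˣ, Represents u A ∧
      (u : WienerMat (Fin 2)) ∈ supported (Set.Ici 0) ∧
        (↑u⁻¹ : WienerMat (Fin 2)) ∈ supported (Set.Ici 0) := by
  constructor
  · rintro ⟨hA, hunit, hA'⟩
    obtain ⟨u, hu⟩ := exists_unit_represents_iff.2 ⟨hA.1, hunit, hA'.1⟩
    exact ⟨u, hu, hu.memWienerPlus_iff.1 hA, hu.matInv.memWienerPlus_iff.1 hA'⟩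
  · rintro ⟨u, hu, hplus, hplus'⟩
    exact ⟨hu.memWienerPlus_iff.2 hplus, (exists_unit_represents_iff.1 ⟨u, hu⟩).2.1,
      hu.matInv.memWienerPlus_iff.2 hplus'⟩

lemma isUnitWienerMinus_iff {A : MatFun} :
    IsUnitWienerMinus A ↔ ∃ u : (WienerMat (Fin 2))ˣ, Represents u A ∧
      (u : WienerMat (Fin 2)) ∈ supported (Set.Iic 0) ∧
        (↑u⁻¹ : WienerMat (Fin 2)) ∈ supported (Set.Iic 0) := by
  constructor
  · rintro ⟨hA, hunit, hA'⟩
    obtain ⟨u, hu⟩ := exists_unit_represents_iff.2 ⟨hA.1, hunit, hA'.1⟩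
    exact ⟨u, hu, hu.memWienerMinus_iff.1 hA, hu.matInv.memWienerMinus_iff.1 hA'⟩
  · rintro ⟨u, hu, hminus, hminus'⟩
    exact ⟨hu.memWienerMinus_iff.2 hminus, (exists_unit_represents_iff.1 ⟨u, hu⟩).2.1,
      hu.matInv.memWienerMinus_iff.2 hminus'⟩

end Represents

section Normalisation

open WienerMat

lemma diag_conj_sub_one_mem_supported_iff {n : Type*} [Fintype n] [DecidableEq n] {ρ : n → ℤ}
    {x : WienerMat n} :
    ↑(diag ρ)⁻¹ * x * ↑(diag ρ) - 1 ∈ supported (Set.Iio 0) ↔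
      ∀ i j k, ρ i - ρ j ≤ k → x i j k = if k = 0 then (1 : Matrix n n ℂ) i j else 0 := by
  simp only [mem_supported, Set.mem_Iio, not_lt, Matrix.sub_apply, WienerAlgebra.sub_apply,
    diag_conj_apply, one_apply_apply, sub_eq_zero]
  refine forall₂_congr fun i j => ((Equiv.subRight (ρ j - ρ i)).forall_congr fun {k} => ?_)
  obtain rfl | hij := eq_or_ne i j
  · simp
  · have hk : ρ i - ρ j ≤ k - (ρ j - ρ i) ↔ 0 ≤ k := by lia
    simp [Matrix.one_apply_ne hij, hk]

lemma diag_conj_sub_one_mem_supported_iff_of_eq (ρ : ℤ) {m : WienerMat (Fin 2)} :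
    ↑(diag ![ρ, ρ])⁻¹ * m * ↑(diag ![ρ, ρ]) - 1 ∈ supported (Set.Iio 0) ↔
      m ∈ supported (Set.Iic 0) ∧ m.map (WienerAlgebra.coef 0) = 1 := by
  rw [diag_conj_sub_one_mem_supported_iff]
  simp only [mem_supported, Set.mem_Iic, ← Matrix.ext_iff, Fin.forall_fin_two,
    Matrix.one_fin_two, Matrix.map_apply, Matrix.of_apply, Matrix.cons_val,
    WienerAlgebra.coef_apply]
  grind

lemma diag_conj_sub_one_mem_supported_iff_of_succ (ρ : ℤ) {m : WienerMat (Fin 2)} :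
    ↑(diag ![ρ, ρ + 1])⁻¹ * m * ↑(diag ![ρ, ρ + 1]) - 1 ∈ supported (Set.Iio 0) ↔
      m ∈ supported (Set.Iic 0) ∧ (∃ l, m.map (WienerAlgebra.coef 0) = !![1, 0; l, 1]) ∧
        m 0 1 (-1) = 0 := by
  rw [diag_conj_sub_one_mem_supported_iff]
  simp only [mem_supported, Set.mem_Iic, ← Matrix.ext_iff, Fin.forall_fin_two,
    Matrix.one_fin_two, Matrix.map_apply, Matrix.of_apply, Matrix.cons_val,
    WienerAlgebra.coef_apply]
  grind

variable {ρ₁ ρ₂ : ℤ}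

lemma mem_supported_of_diag_conj_sub_one (hρ : ρ₁ = ρ₂ ∨ ρ₂ = ρ₁ + 1) {m : WienerMat (Fin 2)}
    (hm : ↑(diag ![ρ₁, ρ₂])⁻¹ * m * ↑(diag ![ρ₁, ρ₂]) - 1 ∈ supported (Set.Iio 0)) :
    m ∈ supported (Set.Iic 0) := by
  rcases hρ with rfl | rfl
  · exact ((diag_conj_sub_one_mem_supported_iff_of_eq _).1 hm).1
  · exact ((diag_conj_sub_one_mem_supported_iff_of_succ _).1 hm).1

lemma diag_conj_mem_supported (hρ : ρ₁ = ρ₂ ∨ ρ₂ = ρ₁ + 1) {m : WienerMat (Fin 2)}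
    (hm : m ∈ supported (Set.Iic 0)) :
    ↑(diag ![ρ₁, ρ₂])⁻¹ * m * ↑(diag ![ρ₁, ρ₂]) ∈ supported (Set.Iic 1) := by
  rw [mem_supported] at hm ⊢
  simp only [Set.mem_Iic, not_le] at hm ⊢
  intro i j k hk
  rw [diag_conj_apply]
  refine hm i j _ ?_
  fin_cases i <;> fin_cases j <;> simp <;> lia

/-- If `z = 1 + w` with `w` a series of negative powers, then `z⁻¹ = 1 - w * z⁻¹` has smaller degree
than `z⁻¹`, unless that degree is at most zero. -/
lemma inv_sub_one_mem_supported {n : Type*} [Fintype n] [DecidableEq n] {z : (WienerMat n)ˣ}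
    (hz : (z : WienerMat n) - 1 ∈ supported (Set.Iio 0)) (N : ℕ)
    (hN : (↑z⁻¹ : WienerMat n) ∈ supported (Set.Iic (N : ℤ))) :
    (↑z⁻¹ : WienerMat n) - 1 ∈ supported (Set.Iio 0) := by
  have hlt {a : ℤ} (ha : (↑z⁻¹ : WienerMat n) ∈ supported (Set.Iic a)) :
      (↑z⁻¹ : WienerMat n) - 1 ∈ supported (Set.Iio a) := by
    have hinv : (↑z⁻¹ : WienerMat n) - 1 = -((z - 1) * ↑z⁻¹) := by
      rw [sub_mul, Units.mul_inv, one_mul, neg_sub]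
    rw [hinv]
    exact neg_mem (mul_mem_supported
      ((Set.Iio_add_Iic_subset 0 a).trans_eq (by rw [zero_add])) hz ha)
  induction N with
  | zero => exact hlt hN
  | succ N ih =>
    refine ih ?_
    rw [← sub_add_cancel (↑z⁻¹ : WienerMat n) 1]
    refine add_mem (supported_mono (fun k hk => ?_) (hlt hN))
      (one_mem_supported (Set.mem_Iic.2 N.cast_nonneg))
    simpa [Int.lt_add_one_iff] using hk

/-- The constant by which a minus factor has to be multiplied for its normalisation not to depend
on `P`. -/
def normaliser (P : (Matrix (Fin 2) (Fin 2) ℂ)ˣ) (ρ₁ ρ₂ : ℤ) : (WienerMat (Fin 2))ˣ :=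
  Units.map const.toMonoidHom (if ρ₁ = ρ₂ then 1 else P⁻¹)

variable (P : (Matrix (Fin 2) (Fin 2) ℂ)ˣ)

lemma normaliser_mem_supported :
    (normaliser P ρ₁ ρ₂ : WienerMat (Fin 2)) ∈ supported (Set.Iic 0) := const_mem_supported _

lemma normaliser_inv_mem_supported :
    (↑(normaliser P ρ₁ ρ₂)⁻¹ : WienerMat (Fin 2)) ∈ supported (Set.Iic 0) := by
  rw [normaliser, ← map_inv]
  exact const_mem_supported _

lemma normaliser_mul_mem_supported_iff {m : WienerMat (Fin 2)} :
    ↑(normaliser P ρ₁ ρ₂) * m ∈ supported (Set.Iic 0) ↔ m ∈ supported (Set.Iic 0) := by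
  refine ⟨fun h => ?_, mul_mem_supported_Iic_zero (normaliser_mem_supported P)⟩
  rw [← Units.inv_mul_cancel_left (normaliser P ρ₁ ρ₂) m]
  exact mul_mem_supported_Iic_zero (normaliser_inv_mem_supported P) h

lemma isPNormalised_iff (hρ : ρ₁ = ρ₂ ∨ ρ₂ = ρ₁ + 1) {y : WienerMat (Fin 2)} {A : MatFun}
    (hA : Represents y A) :
    (y ∈ supported (Set.Iic 0) ∧ IsPNormalised P ρ₁ ρ₂ A) ↔
      ↑(diag ![ρ₁, ρ₂])⁻¹ * (↑(normaliser P ρ₁ ρ₂) * y) * ↑(diag ![ρ₁, ρ₂]) - 1 ∈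
        supported (Set.Iio 0) := by
  rcases hρ with rfl | rfl
  · rw [diag_conj_sub_one_mem_supported_iff_of_eq, normaliser_mul_mem_supported_iff, normaliser,
      if_pos rfl]
    simp [IsPNormalised, hA.matCoef_eq]
  · have hcoef (k : ℤ) : (↑(normaliser P ρ₁ (ρ₁ + 1)) * y).map (WienerAlgebra.coef k) =
        (↑P⁻¹ : Matrix (Fin 2) (Fin 2) ℂ) * matCoef A k := by
      rw [normaliser, if_neg (by simp), hA.matCoef_eq]
      exact const_mul_map_coef _ _ _
    rw [diag_conj_sub_one_mem_supported_iff_of_succ, normaliser_mul_mem_supported_iff, hcoef,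
      ← WienerAlgebra.coef_apply, ← Matrix.map_apply (f := WienerAlgebra.coef (-1)), hcoef]
    simp [IsPNormalised, ← Units.inv_mul_eq_iff_eq_mul (a := P)]

end Normalisation

section Stability

open WienerMat
open scoped Matrix.Norms.Operator

variable {P : (Matrix (Fin 2) (Fin 2) ℂ)ˣ} {ρ₁ ρ₂ : ℤ} {A Am Ap : MatFun}

lemma represents_mul_diag_mul_iff {a y x : WienerMat (Fin 2)} (ha : Represents a A)
    (hy : Represents y Am) (hx : Represents x Ap) :
    (∀ t : ℂ, ‖t‖ = 1 → A t = Am t * diagFactor ρ₁ ρ₂ t * Ap t) ↔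
      a = y * Units.val (diag ![ρ₁, ρ₂]) * x := by
  have hev (t : Circle) : A t = Am t * diagFactor ρ₁ ρ₂ t * Ap t ↔
      ev t a = ev t (y * Units.val (diag ![ρ₁, ρ₂]) * x) := by
    rw [ha t, hy t, hx t, map_mul, map_mul, ev_diag]
  refine ⟨fun h => ext_ev fun t => (hev t).1 (h t t.norm_coe), fun h t ht => ?_⟩
  exact (hev ⟨t, mem_sphere_zero_iff_norm.2 ht⟩).2 (h ▸ rfl)

/-- The factor turning stable `P`-normalised factorisations into canonical ones. -/
def canonicalFactor (P : (Matrix (Fin 2) (Fin 2) ℂ)ˣ) (ρ₁ ρ₂ : ℤ) : (WienerMat (Fin 2))ˣ :=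
  (diag ![ρ₁, ρ₂])⁻¹ * normaliser P ρ₁ ρ₂

lemma normalised_minus_iff (hρ : ρ₁ = ρ₂ ∨ ρ₂ = ρ₁ + 1) {y z : (WienerMat (Fin 2))ˣ}
    (hyz : y = (canonicalFactor P ρ₁ ρ₂)⁻¹ * z * (diag ![ρ₁, ρ₂])⁻¹) (hA : Represents y A) :
    ((y : WienerMat (Fin 2)) ∈ supported (Set.Iic 0) ∧
        (↑y⁻¹ : WienerMat (Fin 2)) ∈ supported (Set.Iic 0) ∧ IsPNormalised P ρ₁ ρ₂ A) ↔
      (z : WienerMat (Fin 2)) - 1 ∈ supported (Set.Iio 0) ∧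
        (↑z⁻¹ : WienerMat (Fin 2)) - 1 ∈ supported (Set.Iio 0) := by
  obtain rfl : z = (diag ![ρ₁, ρ₂])⁻¹ * (normaliser P ρ₁ ρ₂ * y) * diag ![ρ₁, ρ₂] := by
    rw [hyz, canonicalFactor]
    group
  have hz := isPNormalised_iff P hρ hA
  have hinv : ((diag ![ρ₁, ρ₂])⁻¹ * (normaliser P ρ₁ ρ₂ * y) * diag ![ρ₁, ρ₂])⁻¹ =
      (diag ![ρ₁, ρ₂])⁻¹ * (y⁻¹ * (normaliser P ρ₁ ρ₂)⁻¹) * diag ![ρ₁, ρ₂] := by group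
  simp only [hinv, Units.val_mul]
  constructor
  · rintro ⟨hy, hy', hnorm⟩
    refine ⟨hz.1 ⟨hy, hnorm⟩, ?_⟩
    have hdeg := diag_conj_mem_supported hρ
      (mul_mem_supported_Iic_zero hy' (normaliser_inv_mem_supported P (ρ₁ := ρ₁) (ρ₂ := ρ₂)))
    simp only [← Units.val_mul, ← hinv] at hdeg ⊢
    exact inv_sub_one_mem_supported (by simpa only [Units.val_mul] using hz.1 ⟨hy, hnorm⟩) 1 hdeg
  · rintro ⟨hz₁, hz₂⟩
    refine ⟨(hz.2 hz₁).1, ?_, (hz.2 hz₁).2⟩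
    rw [← Units.inv_mul_cancel_right (↑y⁻¹) (normaliser P ρ₁ ρ₂)]
    exact mul_mem_supported_Iic_zero (mem_supported_of_diag_conj_sub_one hρ hz₂)
      (normaliser_mem_supported P)

lemma isStablePFactorisation_iff (hρ : ρ₁ = ρ₂ ∨ ρ₂ = ρ₁ + 1) {a : WienerMat (Fin 2)}
    (ha : Represents a A) :
    IsStablePFactorisation P A ρ₁ ρ₂ Am Ap ↔
      ∃ z x, IsCanonical projPlus (canonicalFactor P ρ₁ ρ₂ * a) z x ∧
        Represents ↑((canonicalFactor P ρ₁ ρ₂)⁻¹ * z * (diag ![ρ₁, ρ₂])⁻¹) Am ∧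
          Represents x Ap := by
  constructor
  · rintro ⟨⟨hminus, hplus, -, heq⟩, -, hnorm⟩
    obtain ⟨y, hy, hy₁, hy₂⟩ := isUnitWienerMinus_iff.1 hminus
    obtain ⟨x, hx, hx₁, hx₂⟩ := isUnitWienerPlus_iff.1 hplus
    obtain ⟨z, rfl⟩ : ∃ z, y = (canonicalFactor P ρ₁ ρ₂)⁻¹ * z * (diag ![ρ₁, ρ₂])⁻¹ :=
      ⟨canonicalFactor P ρ₁ ρ₂ * y * diag ![ρ₁, ρ₂], by group⟩
    obtain ⟨hz₁, hz₂⟩ := (normalised_minus_iff hρ rfl hy).1 ⟨hy₁, hy₂, hnorm⟩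
    refine ⟨z, x, ⟨?_, projPlus_eq_zero_iff.2 hz₁, projPlus_eq_zero_iff.2 hz₂,
      projPlus_eq_self_iff.2 hx₁, projPlus_eq_self_iff.2 hx₂⟩, hy, hx⟩
    rw [(represents_mul_diag_mul_iff ha hy hx).1 heq]
    simp [mul_assoc]
  · rintro ⟨z, x, ⟨heq, hz₁, hz₂, hx₁, hx₂⟩, hy, hx⟩
    obtain ⟨hy₁, hy₂, hnorm⟩ := (normalised_minus_iff hρ rfl hy).2
      ⟨projPlus_eq_zero_iff.1 hz₁, projPlus_eq_zero_iff.1 hz₂⟩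
    refine ⟨⟨isUnitWienerMinus_iff.2 ⟨_, hy, hy₁, hy₂⟩, isUnitWienerPlus_iff.2 ⟨x, hx,
      projPlus_eq_self_iff.1 hx₁, projPlus_eq_self_iff.1 hx₂⟩, by lia,
      (represents_mul_diag_mul_iff ha hy hx).2 ?_⟩, by lia, hnorm⟩
    rw [← Units.inv_mul_cancel_left (canonicalFactor P ρ₁ ρ₂) a, heq]
    simp [mul_assoc]

lemma exists_eventually_wienerNorm_matInv_le {T : Type*} [TopologicalSpace T] {s : T}
    {Y : T → (WienerMat (Fin 2))ˣ} (hY : ContinuousAt Y s) :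
    ∃ C, ∀ᶠ t in 𝓝 s, ∀ B, Represents (Y t) B → wienerNorm (matInv B) ≤ C := by
  have hcont : ContinuousAt (fun t => ∑ i, ∑ j, ‖(↑(Y t)⁻¹ : WienerMat (Fin 2)) i j‖) s := by
    have hval := Units.continuous_val.continuousAt.comp hY.inv
    exact tendsto_finsetSum _ fun i _ => tendsto_finsetSum _ fun j _ =>
      ((continuousAt_pi.1 (continuousAt_pi.1 hval i)) j).norm
  exact ⟨_, (hcont.eventually_le_const (lt_add_one _)).mono fun t ht B hB =>
    hB.matInv.wienerNorm_le.trans ht⟩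

theorem exists_eventually_isStablePFactorisation {a : WienerMat (Fin 2)}
    (ha : Represents a A) (h : IsStablePFactorisation P A ρ₁ ρ₂ Am Ap) :
    ∃ C > 0, ∀ᶠ b in 𝓝 a, ∀ B, Represents b B →
      (∃ Bm Bp, IsStablePFactorisation P B ρ₁ ρ₂ Bm Bp) ∧
      ∀ Bm Bp, IsStablePFactorisation P B ρ₁ ρ₂ Bm Bp →
        wienerNorm (matInv Bm) ≤ C ∧ wienerNorm (matInv Bp) ≤ C := by
  have hρ : ρ₁ = ρ₂ ∨ ρ₂ = ρ₁ + 1 := by have := h.fact.le; have := h.stable; lia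
  obtain ⟨z, x, hzx, -, -⟩ := (isStablePFactorisation_iff hρ ha).1 h
  obtain ⟨Z, X, hZ, hX, hZX⟩ := hzx.exists_continuousAt isSplitting_projPlus
  let φ (b : WienerMat (Fin 2)) : WienerMat (Fin 2) := canonicalFactor P ρ₁ ρ₂ * b
  have hφ : ContinuousAt φ a := by fun_prop
  let Y (b : WienerMat (Fin 2)) := (canonicalFactor P ρ₁ ρ₂)⁻¹ * Z (φ b) * (diag ![ρ₁, ρ₂])⁻¹
  obtain ⟨C, hC⟩ := exists_eventually_wienerNorm_matInv_le (Y := Y)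
    ((continuousAt_const.mul (hZ.comp hφ)).mul continuousAt_const)
  obtain ⟨C', hC'⟩ := exists_eventually_wienerNorm_matInv_le (Y := X ∘ φ) (hX.comp hφ)
  refine ⟨max 1 (max C C'), by positivity, ?_⟩
  filter_upwards [hφ.eventually hZX, hC, hC'] with b hb hm hp B hB
  refine ⟨?_, fun Bm Bp h => ?_⟩
  · obtain ⟨Bm, hBm⟩ := exists_represents (Y b)
    obtain ⟨Bp, hBp⟩ := exists_represents (X (φ b))
    exact ⟨Bm, Bp, (isStablePFactorisation_iff hρ hB).2 ⟨_, _, hb, hBm, hBp⟩⟩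
  · obtain ⟨w, v, hwv, hBm, hBp⟩ := (isStablePFactorisation_iff hρ hB).1 h
    obtain ⟨rfl, rfl⟩ := hwv.unique isSplitting_projPlus hb
    exact ⟨(hm Bm hBm).trans (by simp), (hp Bp hBp).trans (by simp)⟩

end Stability

section Analytic

namespace WienerAlgebra

lemma exists_ev_eq_of_hasSum {f : ℂ → ℂ} {c : ℕ → ℂ} (hc : Summable fun n => ‖c n‖)
    (hf : ∀ t : Circle, HasSum (fun n => c n * (t : ℂ) ^ n) (f t)) :
    ∃ x ∈ supported (Set.Ici 0), x 0 = c 0 ∧ ∀ t : Circle, f t = ev t x := by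
  let y : ℤ → ℂ := Function.extend (fun n : ℕ => (n : ℤ)) c 0
  have hyc (n : ℕ) : y n = c n := Nat.cast_injective.extend_apply c 0 n
  have hy0 : ∀ k ∉ Set.range (fun n : ℕ => (n : ℤ)), y k = 0 := fun k hk =>
    Function.extend_apply' _ _ _ hk
  have hy : Summable fun k => ‖y k‖ := by
    rw [← Nat.cast_injective.summable_iff fun k hk => by rw [hy0 k hk, norm_zero]]
    exact hc.congr fun n => by simp [hyc]
  refine ⟨ofSummable y hy, fun k hk => hy0 k ?_, hyc 0, fun t => ?_⟩
  · rintro ⟨n, rfl⟩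
    exact hk (Set.mem_Ici.2 n.cast_nonneg)
  · refine (hf t).unique (((Nat.cast_injective.hasSum_iff fun k hk => ?_).2
      (hasSum_ev t (ofSummable y hy))).congr_fun fun n => ?_)
    · rw [ofSummable_apply, hy0 k hk, zero_mul]
    · simp [hyc]

lemma exists_ev_eq_of_differentiableOn {f : ℂ → ℂ} {R : ℝ} (hR : 1 < R)
    (hf : DifferentiableOn ℂ f (Metric.closedBall 0 R)) :
    ∃ x ∈ supported (Set.Ici 0), x 0 = f 0 ∧ ∀ t : Circle, f t = ev t x := by
  lift R to NNReal using (zero_lt_one.trans hR).le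
  have hR' : 1 < R := by exact_mod_cast hR
  have hp := hf.hasFPowerSeriesOnBall (zero_lt_one.trans hR')
  have hrad : ((1 : NNReal) : ℝ≥0∞) < (cauchyPowerSeries f 0 R).radius :=
    (ENNReal.coe_lt_coe.2 hR').trans_le hp.r_le
  rw [← hp.coeff_zero 1]
  refine exists_ev_eq_of_hasSum
    (by simpa using (cauchyPowerSeries f 0 R).summable_norm_mul_pow hrad) fun t => ?_
  have ht : (t : ℂ) ∈ Metric.eball 0 R := by
    rw [Metric.eball_coe, mem_ball_zero_iff, Circle.norm_coe]
    exact hR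
  simpa [mul_comm] using hp.hasSum ht

lemma exists_ev_eq_of_differentiableOn_ofReal_lt {f : ℂ → ℂ} {r : ℝ≥0∞} (hr : 1 < r)
    (hf : DifferentiableOn ℂ f {z | ENNReal.ofReal ‖z‖ < r}) :
    ∃ x ∈ supported (Set.Ici 0), ∀ t : Circle, f t = ev t x := by
  obtain ⟨R, hR, hRr⟩ := ENNReal.lt_iff_exists_nnreal_btwn.1 hr
  have hsub : Metric.closedBall (0 : ℂ) R ⊆ {z | ENNReal.ofReal ‖z‖ < r} := fun z hz =>
    (ENNReal.ofReal_le_of_le_toReal (by simpa using hz)).trans_lt hRr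
  obtain ⟨x, hx, -, hfx⟩ :=
    exists_ev_eq_of_differentiableOn (by exact_mod_cast hR) (hf.mono hsub)
  exact ⟨x, hx, hfx⟩

/-- The series `x (t⁻¹)`. -/
def reflect (x : WienerAlgebra) : WienerAlgebra :=
  ofSummable (fun k => x (-k)) ((Equiv.neg ℤ).summable_iff.2 x.hasSum_norm.summable)

@[simp] lemma reflect_apply (x : WienerAlgebra) (k : ℤ) : reflect x k = x (-k) := rfl

lemma ev_reflect (t : Circle) (x : WienerAlgebra) : ev t (reflect x) = ev t⁻¹ x := by
  refine (hasSum_ev t (reflect x)).unique ?_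
  refine ((Equiv.neg ℤ).hasSum_iff.2 (hasSum_ev t⁻¹ x)).congr_fun fun k => ?_
  simp

lemma exists_ev_eq_of_differentiableOn_compl {f : ℂ → ℂ} {r : ℝ} (hr : r < 1)
    (hf : DifferentiableOn ℂ f {z | r < ‖z‖})
    (hf_inf : Tendsto f (Bornology.cobounded ℂ) (𝓝 0)) :
    ∃ y ∈ supported (Set.Iio 0), ∀ t : Circle, f t = ev t y := by
  obtain ⟨s, hs, hs1⟩ := exists_between (max_lt hr zero_lt_one)
  obtain ⟨hrs, hs0⟩ := max_lt_iff.1 hs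
  let g : ℂ → ℂ := Function.update (fun w => f w⁻¹) 0 0
  have hg {w : ℂ} (hw : w ≠ 0) : g w = f w⁻¹ := Function.update_of_ne hw _ _
  have hd : DifferentiableOn ℂ g (Metric.closedBall 0 s⁻¹) := by
    rw [← Complex.differentiableOn_compl_singleton_and_continuousAt_iff
      (Metric.closedBall_mem_nhds 0 (inv_pos.2 hs0))]
    refine ⟨?_, continuousAt_update_same.2 (hf_inf.comp tendsto_inv₀_nhdsNE_zero)⟩
    refine (hf.comp (differentiableOn_inv.mono fun w hw => hw.2) fun w hw => ?_).congr
      fun w hw => hg hw.2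
    have hw' : ‖w‖ ≤ s⁻¹ := by simpa using hw.1
    rw [Set.mem_ofPred_eq, norm_inv]
    exact hrs.trans_le ((le_inv_comm₀ hs0 (norm_pos_iff.2 hw.2)).2 hw')
  obtain ⟨x, hx, hx0, hgx⟩ := exists_ev_eq_of_differentiableOn ((one_lt_inv₀ hs0).2 hs1) hd
  refine ⟨reflect x, fun k hk => ?_, fun t => ?_⟩
  · rw [reflect_apply]
    obtain rfl | hk := (Set.notMem_Iio.1 hk).eq_or_lt
    · rw [neg_zero, hx0]
      exact Function.update_self ..
    · exact hx _ (by simpa using hk)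
  · rw [ev_reflect, ← hgx, hg (t⁻¹).coe_ne_zero, Circle.coe_inv, inv_inv]

lemma tendsto_sum_monomial {S : Set ℤ} {x : WienerAlgebra} (hx : x ∈ supported S)
    {s : ℕ → Finset ℤ} (hs : ∀ N : ℕ, s N ⊆ Finset.Icc (-N : ℤ) N)
    (hS : ∀ N : ℕ, ∀ k ∈ Finset.Icc (-N : ℤ) N, k ∈ S → k ∈ s N) :
    Tendsto (fun N => ∑ k ∈ s N, x k • monomial k) atTop (𝓝 x) := by
  refine ((hasSum_monomial x).comp Finset.tendsto_Icc_neg).congr fun N => ?_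
  refine (Finset.sum_subset (hs N) fun k hk hks => ?_).symm
  rw [hx k fun hkS => hks (hS N k hk hkS), zero_smul]

lemma sum_fourierCoef_mul_zpow {f : ℂ → ℂ} {x : WienerAlgebra} (h : ∀ t : Circle, f t = ev t x)
    (s : Finset ℤ) (t : Circle) :
    ∑ k ∈ s, fourierCoef f k * (t : ℂ) ^ k = ev t (∑ k ∈ s, x k • monomial k) := by
  simp [map_sum, fourierCoef_eq_of_ev h]

end WienerAlgebra

open WienerAlgebra WienerMat

/-- The Fourier series of the matrix function in reduced form. -/
def reducedSeries (θ : ℤ) (x y : WienerAlgebra) : WienerMat (Fin 2) :=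
  !![1, y; x, monomial θ + x * y]

lemma continuous_reducedSeries (θ : ℤ) :
    Continuous fun p : WienerAlgebra × WienerAlgebra => reducedSeries θ p.1 p.2 := by
  refine continuous_matrix fun i j => ?_
  fin_cases i <;> fin_cases j <;> simp only [reducedSeries] <;> dsimp <;> fun_prop

lemma represents_reducedForm (θ : ℤ) {α β : ℂ → ℂ} {x y : WienerAlgebra}
    (hα : ∀ t : Circle, α t = WienerAlgebra.ev t x)
    (hβ : ∀ t : Circle, β t = WienerAlgebra.ev t y) :
    Represents (reducedSeries θ x y) (reducedForm θ α β) := fun t => by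
  ext i j
  fin_cases i <;> fin_cases j <;> simp [reducedSeries, reducedForm, hα, hβ]

lemma represents_reducedTrunc (θ : ℤ) {α β : ℂ → ℂ} {x y : WienerAlgebra}
    (hα : ∀ t : Circle, α t = WienerAlgebra.ev t x)
    (hβ : ∀ t : Circle, β t = WienerAlgebra.ev t y) (N : ℕ) :
    Represents (reducedSeries θ (∑ k ∈ Finset.Icc (0 : ℤ) N, x k • monomial k)
      (∑ k ∈ Finset.Icc (-N : ℤ) (-1), y k • monomial k)) (reducedTrunc θ α β N) :=
  represents_reducedForm θ (sum_fourierCoef_mul_zpow hα _) (sum_fourierCoef_mul_zpow hβ _)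

lemma exists_represents_reducedTrunc_tendsto {r₁ : ℝ} {r₂ : ℝ≥0∞} (hr₁ : r₁ < 1) (hr₂ : 1 < r₂)
    (θ : ℤ) {α β : ℂ → ℂ} (hα : DifferentiableOn ℂ α {z | ENNReal.ofReal ‖z‖ < r₂})
    (hβ : DifferentiableOn ℂ β {z | r₁ < ‖z‖})
    (hβ_inf : Tendsto β (Bornology.cobounded ℂ) (𝓝 0)) :
    ∃ a, ∃ b : ℕ → WienerMat (Fin 2), Represents a (reducedForm θ α β) ∧
      (∀ N, Represents (b N) (reducedTrunc θ α β N)) ∧ Tendsto b atTop (𝓝 a) := by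
  obtain ⟨x, hx, hαx⟩ := exists_ev_eq_of_differentiableOn_ofReal_lt hr₂ hα
  obtain ⟨y, hy, hβy⟩ := exists_ev_eq_of_differentiableOn_compl hr₁ hβ hβ_inf
  have hxN := tendsto_sum_monomial hx (s := fun N => Finset.Icc (0 : ℤ) N)
    (fun N => Finset.Icc_subset_Icc (by lia) le_rfl)
    fun N k hk hk0 => Finset.mem_Icc.2 ⟨hk0, (Finset.mem_Icc.1 hk).2⟩
  have hyN := tendsto_sum_monomial hy (s := fun N => Finset.Icc (-N : ℤ) (-1))
    (fun N => Finset.Icc_subset_Icc le_rfl (by lia))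
    fun N k hk hk0 => by
      rw [Set.mem_Iio] at hk0
      exact Finset.mem_Icc.2 ⟨(Finset.mem_Icc.1 hk).1, by lia⟩
  have hlim := ((continuous_reducedSeries θ).tendsto (x, y)).comp (hxN.prodMk_nhds hyN)
  exact ⟨_, _, represents_reducedForm θ hαx hβy, represents_reducedTrunc θ hαx hβy, hlim⟩

end Analytic

section ErrorBound

lemma maxCircle_nonneg (f : ℂ → ℂ) (ζ : ℝ) : 0 ≤ maxCircle f ζ :=
  Real.sSup_nonneg (Set.forall_mem_image.2 fun _ _ => norm_nonneg _)

lemma exists_maxCircle_le {f : ℂ → ℂ} {s : Set ℂ} (hs : IsCompact s) (hf : ContinuousOn f s) :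
    ∃ C, ∀ ζ, Metric.sphere 0 ζ ⊆ s → maxCircle f ζ ≤ C := by
  obtain ⟨C, hC⟩ := hs.exists_bound_of_continuousOn hf
  exact ⟨max C 0, fun ζ hζ => Real.sSup_le
    (Set.forall_mem_image.2 fun t ht => le_max_of_le_left (hC t (hζ ht))) (le_max_right C 0)⟩

/-- The bound `δ_N(ζ₁, ζ₂)` as a function of the maxima `A = M₊(ζ₂)` and `B = M₋(ζ₁)`. -/
def errorBound (N : ℕ) (ζ₁ ζ₂ A B : ℝ) : ℝ :=
  (1 + ζ₂ * A / (ζ₂ - 1)) * (ζ₁ ^ (N + 1) * B / (1 - ζ₁)) +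
    (1 + ζ₁ * B / (1 - ζ₁)) * (A / (ζ₂ ^ N * (ζ₂ - 1)))

lemma errorBound_nonneg (N : ℕ) {ζ₁ ζ₂ A B : ℝ} (h₁ : 0 ≤ ζ₁) (h₁' : ζ₁ < 1) (h₂ : 1 < ζ₂)
    (hA : 0 ≤ A) (hB : 0 ≤ B) : 0 ≤ errorBound N ζ₁ ζ₂ A B := by
  have : 0 < 1 - ζ₁ := sub_pos.2 h₁'
  have : 0 < ζ₂ - 1 := sub_pos.2 h₂
  unfold errorBound
  positivity

lemma div_sub_one_antitoneOn : AntitoneOn (fun x : ℝ => x / (x - 1)) (Set.Ioi 1) :=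
  fun x hx y hy hxy => by
    rw [div_le_div_iff₀ (sub_pos.2 hy) (sub_pos.2 hx)]
    linarith

lemma errorBound_mono (N : ℕ) {ζ₁ ζ₁' ζ₂ ζ₂' A A' B B' : ℝ} (h₁ : 0 ≤ ζ₁) (h₁' : ζ₁' < 1)
    (h₂ : 1 < ζ₂') (hA : 0 ≤ A) (hB : 0 ≤ B) (hζ₁ : ζ₁ ≤ ζ₁') (hζ₂ : ζ₂' ≤ ζ₂) (hAA' : A ≤ A')
    (hBB' : B ≤ B') : errorBound N ζ₁ ζ₂ A B ≤ errorBound N ζ₁' ζ₂' A' B' := by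
  have : 0 < 1 - ζ₁' := sub_pos.2 h₁'
  have : 0 < ζ₂' - 1 := sub_pos.2 h₂
  have hquot : ζ₂ * A / (ζ₂ - 1) ≤ ζ₂' * A' / (ζ₂' - 1) := by
    rw [mul_div_right_comm, mul_div_right_comm]
    exact mul_le_mul (div_sub_one_antitoneOn h₂ (h₂.trans_le hζ₂) hζ₂) hAA' hA (by positivity)
  have : 0 ≤ B' := hB.trans hBB'
  have : 0 ≤ A' := hA.trans hAA'
  have : 0 ≤ ζ₁' := h₁.trans hζ₁
  have : 0 < 1 - ζ₁ := by linarith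
  have : 0 < ζ₂ - 1 := by linarith
  have : 0 < ζ₂ := by linarith
  unfold errorBound
  gcongr

lemma tendsto_errorBound {ζ₁ ζ₂ : ℝ} (h₁ : 0 ≤ ζ₁) (h₁' : ζ₁ < 1) (h₂ : 1 < ζ₂) (A B : ℝ) :
    Tendsto (fun N => errorBound N ζ₁ ζ₂ A B) atTop (𝓝 0) := by
  have hpow : Tendsto (fun N => ζ₁ ^ (N + 1)) atTop (𝓝 0) :=
    (tendsto_pow_atTop_nhds_zero_of_lt_one h₁ h₁').comp (tendsto_add_atTop_nat 1)
  have hinv : Tendsto (fun N => (ζ₂ ^ N * (ζ₂ - 1))⁻¹) atTop (𝓝 0) :=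
    ((tendsto_pow_atTop_atTop_of_one_lt h₂).atTop_mul_const (sub_pos.2 h₂)).inv_tendsto_atTop
  simpa [errorBound, div_eq_mul_inv] using
    (((hpow.mul_const B).div_const (1 - ζ₁)).const_mul (1 + ζ₂ * A / (ζ₂ - 1))).add
      ((hinv.const_mul A).const_mul (1 + ζ₁ * B / (1 - ζ₁)))

variable {r₁ : ℝ} {r₂ : ℝ≥0∞} {α β : ℂ → ℂ} {ζ : ℝ × ℝ} {K : Set (ℝ × ℝ)}

lemma nonneg_of_mem_admissible (hr₁ : 0 ≤ r₁) (hζ : ζ ∈ admissible r₁ r₂ α β) : 0 ≤ ζ.1 := by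
  obtain h | ⟨h, -, -⟩ := hζ.1.2
  exacts [hr₁.trans h.le, hr₁.trans_eq h.symm]

lemma continuousOn_closedBall_of_mem_admissible
    (hα : DifferentiableOn ℂ α {z | ENNReal.ofReal ‖z‖ < r₂})
    (hζ : ζ ∈ admissible r₁ r₂ α β) : ContinuousOn α (Metric.closedBall 0 ζ.2) := by
  have hle {z : ℂ} (hz : z ∈ Metric.closedBall 0 ζ.2) :
      ENNReal.ofReal ‖z‖ ≤ ENNReal.ofReal ζ.2 :=
    ENNReal.ofReal_le_ofReal (mem_closedBall_zero_iff.1 hz)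
  obtain h | ⟨h, hα'⟩ := hζ.2.2
  · exact hα.continuousOn.mono fun z hz => (hle hz).trans_lt h
  · exact hα'.mono fun z hz => (hle hz).trans_eq h

lemma continuousOn_compl_ball_of_mem_admissible (hβ : DifferentiableOn ℂ β {z | r₁ < ‖z‖})
    (hζ : ζ ∈ admissible r₁ r₂ α β) : ContinuousOn β {z | ζ.1 ≤ ‖z‖} := by
  obtain h | ⟨h, -, hβ'⟩ := hζ.1.2
  · exact hβ.continuousOn.mono fun z hz => h.trans_le hz
  · rwa [h]

lemma exists_maxCircle_snd_le (hα : DifferentiableOn ℂ α {z | ENNReal.ofReal ‖z‖ < r₂})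
    (hK : IsCompact K) (hKne : K.Nonempty) (hKa : K ⊆ admissible r₁ r₂ α β) :
    ∃ A, ∀ ζ ∈ K, maxCircle α ζ.2 ≤ A := by
  obtain ⟨ξ, hξ, hmax⟩ := hK.exists_isMaxOn hKne continuous_snd.continuousOn
  obtain ⟨A, hA⟩ := exists_maxCircle_le (isCompact_closedBall 0 ξ.2)
    (continuousOn_closedBall_of_mem_admissible hα (hKa hξ))
  exact ⟨A, fun ζ hζ => hA _ (Metric.sphere_subset_closedBall.trans
    (Metric.closedBall_subset_closedBall (hmax hζ)))⟩

lemma exists_maxCircle_fst_le (hβ : DifferentiableOn ℂ β {z | r₁ < ‖z‖})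
    (hK : IsCompact K) (hKne : K.Nonempty) (hKa : K ⊆ admissible r₁ r₂ α β) :
    ∃ B, ∀ ζ ∈ K, maxCircle β ζ.1 ≤ B := by
  obtain ⟨ξ, hξ, hmin⟩ := hK.exists_isMinOn hKne continuous_fst.continuousOn
  obtain ⟨B, hB⟩ := exists_maxCircle_le
    ((isCompact_closedBall 0 1).inter_right (isClosed_le continuous_const continuous_norm))
    ((continuousOn_compl_ball_of_mem_admissible hβ (hKa hξ)).mono Set.inter_subset_right)
  refine ⟨B, fun ζ hζ => hB _ fun z hz => ?_⟩
  have hz' : ‖z‖ = ζ.1 := mem_sphere_zero_iff_norm.1 hz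
  exact ⟨mem_closedBall_zero_iff.2 (hz'.trans_le (hKa hζ).1.1.le), (hmin hζ).trans_eq hz'.symm⟩

lemma delta_nonneg (hr₁ : 0 ≤ r₁) (hζ : ζ ∈ admissible r₁ r₂ α β) (N : ℕ) :
    0 ≤ delta α β N ζ.1 ζ.2 :=
  errorBound_nonneg N (nonneg_of_mem_admissible hr₁ hζ) hζ.1.1 hζ.2.1 (maxCircle_nonneg ..)
    (maxCircle_nonneg ..)

lemma eventually_forall_delta_lt (hr₁ : 0 ≤ r₁)
    (hα : DifferentiableOn ℂ α {z | ENNReal.ofReal ‖z‖ < r₂})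
    (hβ : DifferentiableOn ℂ β {z | r₁ < ‖z‖}) (hK : IsCompact K)
    (hKa : K ⊆ admissible r₁ r₂ α β) {ε : ℝ} (hε : 0 < ε) :
    ∀ᶠ N in atTop, ∀ ζ ∈ K, delta α β N ζ.1 ζ.2 < ε := by
  obtain rfl | hKne := K.eq_empty_or_nonempty
  · simp
  obtain ⟨A, hA⟩ := exists_maxCircle_snd_le hα hK hKne hKa
  obtain ⟨B, hB⟩ := exists_maxCircle_fst_le hβ hK hKne hKa
  obtain ⟨ξ, hξ, hmax⟩ := hK.exists_isMaxOn hKne continuous_fst.continuousOn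
  obtain ⟨η, hη, hmin⟩ := hK.exists_isMinOn hKne continuous_snd.continuousOn
  have hlim := tendsto_errorBound (nonneg_of_mem_admissible hr₁ (hKa hξ)) (hKa hξ).1.1
    (hKa hη).2.1 A B
  filter_upwards [hlim.eventually_lt_const hε] with N hN ζ hζ
  exact (errorBound_mono N (nonneg_of_mem_admissible hr₁ (hKa hζ)) (hKa hξ).1.1 (hKa hη).2.1
    (maxCircle_nonneg ..) (maxCircle_nonneg ..) (hmax hζ) (hmin hζ) (hA ζ hζ) (hB ζ hζ)).trans_lt
    hN

lemma sigma_pos (θ : ℤ) : 0 < sigma θ := by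
  unfold sigma
  split_ifs <;> norm_num

lemma wienerNorm_nonneg (A : MatFun) : 0 ≤ wienerNorm A :=
  tsum_nonneg fun _ => le_max_of_le_left (by positivity)

lemma qValue_lt_one {θ : ℤ} {N : ℕ} {Am Ap : MatFun} {ζ₁ ζ₂ C : ℝ} (hC : 0 < C)
    (hm : wienerNorm (matInv Am) ≤ C) (hp : wienerNorm (matInv Ap) ≤ C)
    (hδ₀ : 0 ≤ delta α β N ζ₁ ζ₂) (hδ : delta α β N ζ₁ ζ₂ < 1 / (sigma θ * C * C)) :
    qValue θ α β N Am Ap ζ₁ ζ₂ < 1 := by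
  have hσ := sigma_pos θ
  calc qValue θ α β N Am Ap ζ₁ ζ₂ ≤ sigma θ * delta α β N ζ₁ ζ₂ * C * C := by
        unfold qValue
        have := wienerNorm_nonneg (matInv Am)
        gcongr
    _ = delta α β N ζ₁ ζ₂ * (sigma θ * C * C) := by ring
    _ < 1 := (lt_div_iff₀ (by positivity)).1 hδ

end ErrorBound

lemma isUnit_J₂ : IsUnit J₂ := (Matrix.isUnit_iff_isUnit_det J₂).2 (by simp [J₂])

end WienerHopf

end

theorem theorem4p1_general
    (r₁ : ℝ) (r₂ : ENNReal) (hr₁ : 0 ≤ r₁) (hr₁' : r₁ < 1) (hr₂ : 1 < r₂)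
    (θ : ℤ) (α β : ℂ → ℂ)
    (hα : DifferentiableOn ℂ α {z | ENNReal.ofReal ‖z‖ < r₂})
    (hβ : DifferentiableOn ℂ β {z | r₁ < ‖z‖})
    (hβ_inf : Filter.Tendsto β (Bornology.cobounded ℂ) (nhds 0))
    (P : Matrix (Fin 2) (Fin 2) ℂ) (hP : IsUnit P)
    (ρ₁ ρ₂ : ℤ) (am ap : WienerHopf.MatFun)
    (ha : WienerHopf.IsStablePFactorisation P (WienerHopf.reducedForm θ α β) ρ₁ ρ₂ am ap) :
    ∃ N₀ : ℕ,
      (∀ N : ℕ, N₀ < N → ∃ amN apN : WienerHopf.MatFun,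
        WienerHopf.IsStablePFactorisation P (WienerHopf.reducedTrunc θ α β N) ρ₁ ρ₂ amN apN) ∧
      ∀ K : Set (ℝ × ℝ), IsCompact K → K ⊆ WienerHopf.admissible r₁ r₂ α β →
        ∃ N₁ : ℕ, N₀ ≤ N₁ ∧ ∀ N : ℕ, N₁ < N → ∀ amN apN : WienerHopf.MatFun,
          WienerHopf.IsStablePFactorisation P (WienerHopf.reducedTrunc θ α β N) ρ₁ ρ₂ amN apN →
          ∀ ζ ∈ K, WienerHopf.qValue θ α β N amN apN ζ.1 ζ.2 < 1 := by
  obtain ⟨P, rfl⟩ := hP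
  obtain ⟨a, b, hab, hb, hlim⟩ :=
    WienerHopf.exists_represents_reducedTrunc_tendsto hr₁' hr₂ θ hα hβ hβ_inf
  obtain ⟨C, hC, hfact⟩ := WienerHopf.exists_eventually_isStablePFactorisation hab ha
  obtain ⟨N₀, hN₀⟩ := Filter.eventually_atTop.1 (hlim.eventually hfact)
  refine ⟨N₀, fun N hN => (hN₀ N hN.le _ (hb N)).1, fun K hK hKa => ?_⟩
  have hσ := WienerHopf.sigma_pos θ
  obtain ⟨N₁, hN₁⟩ := Filter.eventually_atTop.1 (WienerHopf.eventually_forall_delta_lt hr₁ hα hβ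
    hK hKa (one_div_pos.2 (mul_pos (mul_pos hσ hC) hC)))
  refine ⟨max N₀ N₁, le_max_left .., fun N hN amN apN hN' ζ hζ => ?_⟩
  obtain ⟨hN₀', hN₁'⟩ := max_lt_iff.1 hN
  obtain ⟨hm, hp⟩ := (hN₀ N hN₀'.le _ (hb N)).2 amN apN hN'
  exact WienerHopf.qValue_lt_one hC hm hp (WienerHopf.delta_nonneg hr₁ (hKa hζ) N)
    (hN₁ N hN₁'.le ζ hζ)

theorem theorem4p1
    (r₁ : ℝ) (r₂ : ENNReal) (hr₁ : 0 ≤ r₁) (hr₁' : r₁ < 1) (hr₂ : 1 < r₂)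
    (θ : ℤ) (α β : ℂ → ℂ)
    (hα : DifferentiableOn ℂ α {z | ENNReal.ofReal ‖z‖ < r₂})
    (hβ : DifferentiableOn ℂ β {z | r₁ < ‖z‖})
    (hβ_inf : Filter.Tendsto β (Bornology.cobounded ℂ) (nhds 0))
    (P : Matrix (Fin 2) (Fin 2) ℂ) (hP : P = 1 ∨ P = WienerHopf.J₂)
    (ρ₁ ρ₂ : ℤ) (am ap : WienerHopf.MatFun)
    (ha : WienerHopf.IsStablePFactorisation P (WienerHopf.reducedForm θ α β) ρ₁ ρ₂ am ap) :
    ∃ N₀ : ℕ,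
      (∀ N : ℕ, N₀ < N → ∃ amN apN : WienerHopf.MatFun,
        WienerHopf.IsStablePFactorisation P (WienerHopf.reducedTrunc θ α β N) ρ₁ ρ₂ amN apN) ∧
      ∀ K : Set (ℝ × ℝ), IsCompact K → K ⊆ WienerHopf.admissible r₁ r₂ α β →
        ∃ N₁ : ℕ, N₀ ≤ N₁ ∧ ∀ N : ℕ, N₁ < N → ∀ amN apN : WienerHopf.MatFun,
          WienerHopf.IsStablePFactorisation P (WienerHopf.reducedTrunc θ α β N) ρ₁ ρ₂ amN apN →
          ∀ ζ ∈ K, WienerHopf.qValue θ α β N amN apN ζ.1 ζ.2 < 1 := by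
  refine theorem4p1_general r₁ r₂ hr₁ hr₁' hr₂ θ α β hα hβ hβ_inf P ?_ ρ₁ ρ₂ am ap ha
  obtain rfl | rfl := hP
  exacts [isUnit_one, WienerHopf.isUnit_J₂]
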